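/- Definitions. Let $X$ be a metric space. For $\mu\ge 1$, $c\ge 0$, a $(\mu,c)$-quasi-geodesic is a (not necessarily continuous) map $\gamma$ from a compact interval (or from $\mathbb Z$) to $X$ with $\mu^{-1}|s-t|-c\le d(\gamma(s),\gamma(t))\le \mu|s-t|+c$ for all $s,t$. A path system $\mathcal{PS}$ on $X$ is a collection of $(\mu,\mu)$-quasi-geodesics defined on compact intervals (called special paths), for some fixed $\mu$, that is closed under taking subpaths and contains, for all $x,y\in X$, a path from $x$ to $y$. A weak path system $(X,\mathcal{PS})$ on a group $G$ is an isometric action of $G$ on $X$ preserving $\mathcal{PS}$. A map $\pi_A:X\to A\subseteq X$ is a projection with constant $C$ if $d(\pi_A(x),x)\le C$ for all $x\in A$ and, whenever $d(\pi_A(x),\pi_A(y))\ge C$, every special path from $x$ to $y$ is at distance at most $C$ from both $\pi_A(x)$ and $\pi_A(y)$. An element $g\in G$ is WPD if every orbit $\langle g\rangle x$ is a quasi-geodesic that is Morse (for all $\mu,c$ there is $M$ such that every $(\mu,c)$-quasi-geodesic with endpoints on $\langle g\rangle x$ stays in the $M$-neighbourhood of $\langle g\rangle x$) and for all $R\ge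 0$, $x\in X$ there is $N$ such that $\{h\in G: d(x,hx)\le R,\ d(hg^Nx,g^Nx)\le R\}$ is finite. A $C$-contracting axis of $g$ is a nonempty $g$-invariant set $A\subseteq X$ on which $\langle g\rangle$ acts coboundedly, together with a projection $\pi_A$ on $A$ with constant $C$. The element $g$ is weakly contracting if it has infinite order, is WPD and has a $C$-contracting axis for some $C$. For $g$ weakly contracting with axis $A$, $E(g)$ denotes the set of all $h\in G$ such that $\pi_A(hA)$ has finite Hausdorff distance from $A$. Theorem. Let $(X,\mathcal{PS})$ be a weak path system on the group $G$. For each $C$ and each subset $A\subseteq X$ there exists $D$, depending only on $(X,\mathcal{PS})$, the action, $C$ and $A$, with the following properties for every weakly contracting $g\in G$ that has $A$ as a $C$-contracting axis, every projection $\pi_A$ on $A$ with constant $C$, and every $p\in A$. (1) If $h\in G\setminus E(g)$ satisfies $$d(p,gp)\ \ge\ d(\pi_A(hp),p)+d(p,\pi_A(h^{-1}p))+D,$$ then $hg$, and every conjugate of it, is weakly contracting. (2) If $h_1,h_2\in G\setminus E(g)$ and $n_1,n_2\in\mathbb Z$ satisfy $$d(p,g^{n_1}p)\ \ge\ d(\pi_A(h_1^{-1}p),p)+d(p,\pi_A(h_2p))+D,$$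 $$d(p,g^{n_2}p)\ \ge\ d(\pi_A(h_1p),p)+d(p,\pi_A(h_2^{-1}p))+D,$$ then $h_1g^{n_1}h_2g^{n_2}$, and every conjugate of it, is weakly contracting. -/

import Mathlib

open scoped Pointwise

/-- `f` is a `(μ, c)`-quasi-isometric embedding. For `T` a compact interval this says that `f` is a
`(μ, c)`-quasi-geodesic (not necessarily continuous). -/
def IsQuasiGeodesic {T X : Type*} [MetricSpace T] [MetricSpace X] (μ c : ℝ) (f : T → X) : Prop :=
  ∀ s t : T, μ⁻¹ * dist s t - c ≤ dist (f s) (f t) ∧ dist (f s) (f t) ≤ μ * dist s t + c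

/-- A (not necessarily continuous) map from a compact interval `[lo, hi]` to `X`. -/
structure IntervalPath (X : Type*) where
  lo : ℝ
  hi : ℝ
  le : lo ≤ hi
  toFun : Set.Icc lo hi → X

namespace IntervalPath

variable {X : Type*}

/-- The starting point. -/
def source (γ : IntervalPath X) : X := γ.toFun ⟨γ.lo, le_refl _, γ.le⟩

/-- The end point. -/
def target (γ : IntervalPath X) : X := γ.toFun ⟨γ.hi, γ.le, le_refl _⟩

/-- The image of the path. -/
def image (γ : IntervalPath X) : Set X := Set.range γ.toFun

/-- The restriction of the path to a subinterval `[a, b]`. -/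
def subpath (γ : IntervalPath X) (a b : ℝ) (ha : γ.lo ≤ a) (hab : a ≤ b) (hb : b ≤ γ.hi) :
    IntervalPath X where
  lo := a
  hi := b
  le := hab
  toFun := fun t => γ.toFun ⟨t, ha.trans t.2.1, t.2.2.trans hb⟩

/-- The image of a path under a map. -/
def map {Y : Type*} (f : X → Y) (γ : IntervalPath X) : IntervalPath Y where
  lo := γ.lo
  hi := γ.hi
  le := γ.le
  toFun := fun t => f (γ.toFun t)

end IntervalPath

/-- A path system: a collection of `(μ, μ)`-quasi-geodesics, for some `μ`, closed under subpaths
and connecting any two points. -/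
structure PathSystem (X : Type*) [MetricSpace X] where
  paths : Set (IntervalPath X)
  quasiGeodesic : ∃ μ : ℝ, 1 ≤ μ ∧ ∀ γ ∈ paths, IsQuasiGeodesic μ μ γ.toFun
  subpath_mem : ∀ γ ∈ paths, ∀ (a b : ℝ) (ha : γ.lo ≤ a) (hab : a ≤ b) (hb : b ≤ γ.hi),
    γ.subpath a b ha hab hb ∈ paths
  connects : ∀ x y : X, ∃ γ ∈ paths, γ.source = x ∧ γ.target = y

/-- `G` preserves the path system. Together with an isometric action this is a weak path system
on the group `G`. -/
def PathSystem.IsInvariant {X : Type*} [MetricSpace X] (PS : PathSystem X)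
    (G : Type*) [Group G] [MulAction G X] : Prop :=
  ∀ (g : G), ∀ γ ∈ PS.paths, γ.map (fun x => g • x) ∈ PS.paths

/-- `π` is a projection on `A` with constant `C` relative to the path system, so that `A` is
contracting with constant `C`. -/
structure IsProjection {X : Type*} [MetricSpace X] (PS : PathSystem X) (C : ℝ)
    (A : Set X) (π : X → X) : Prop where
  mem : ∀ x, π x ∈ A
  dist_le : ∀ x ∈ A, dist (π x) x ≤ C
  near : ∀ x y : X, C ≤ dist (π x) (π y) →
    ∀ δ ∈ PS.paths, δ.source = x → δ.target = y →
      Metric.infDist (π x) δ.image ≤ C ∧ Metric.infDist (π y) δ.image ≤ C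

/-- The orbit of `x` under `⟨g⟩` is a quasi-geodesic and is Morse: quasi-geodesics with endpoints
on the orbit stay close to it, with a bound depending only on the quasi-geodesic constants. -/
def HasMorseQuasiGeodesicOrbit {G X : Type*} [Group G] [MetricSpace X] [MulAction G X]
    (g : G) (x : X) : Prop :=
  (∃ ν : ℝ, 1 ≤ ν ∧ IsQuasiGeodesic ν ν (fun n : ℤ => g ^ n • x)) ∧
  ∀ μ c : ℝ, 1 ≤ μ → 0 ≤ c → ∃ M : ℝ, ∀ γ : IntervalPath X, IsQuasiGeodesic μ c γ.toFun →
    γ.source ∈ Set.range (fun n : ℤ => g ^ n • x) →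
    γ.target ∈ Set.range (fun n : ℤ => g ^ n • x) →
    ∀ y ∈ γ.image, Metric.infDist y (Set.range (fun n : ℤ => g ^ n • x)) ≤ M

/-- The WPD property. -/
def IsWPD {G : Type*} (X : Type*) [Group G] [MetricSpace X] [MulAction G X] (g : G) : Prop :=
  (∀ x : X, HasMorseQuasiGeodesicOrbit g x) ∧
  ∀ R : ℝ, 0 ≤ R → ∀ x : X, ∃ N : ℕ,
    {h : G | dist x (h • x) ≤ R ∧ dist ((h * g ^ N) • x) (g ^ N • x) ≤ R}.Finite

/-- `A` is a nonempty `g`-invariant set on which `⟨g⟩` acts coboundedly. (An axis of `g` is such a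
set which moreover is contracting, i.e. which admits a projection.) -/
structure IsCoboundedInvariant {G X : Type*} [Group G] [MetricSpace X] [MulAction G X]
    (g : G) (A : Set X) : Prop where
  nonempty : A.Nonempty
  invariant : g • A = A
  cobounded : ∃ R : ℝ, ∀ x ∈ A, ∀ y ∈ A, ∃ n : ℤ, dist (g ^ n • x) y ≤ R

/-- `A` is an axis of `g`, contracting with constant `C` by means of the projection `π`. -/
def IsContractingAxis {G X : Type*} [Group G] [MetricSpace X] [MulAction G X]
    (PS : PathSystem X) (g : G) (C : ℝ) (A : Set X) (π : X → X) : Prop :=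
  IsCoboundedInvariant g A ∧ IsProjection PS C A π

/-- Weakly contracting elements: infinite order, WPD, and with a contracting axis. -/
def IsWeaklyContracting {G X : Type*} [Group G] [MetricSpace X] [MulAction G X]
    (PS : PathSystem X) (g : G) : Prop :=
  ¬ IsOfFinOrder g ∧ IsWPD X g ∧
    ∃ (C : ℝ) (A : Set X) (π : X → X), IsContractingAxis PS g C A π

/-- `E(g)`, for `g` with axis `A` and projection `π`: all `h` such that `π(hA)` has finite
Hausdorff distance from `A`. -/
def elementaryHull (G : Type*) {X : Type*} [Group G] [MetricSpace X] [MulAction G X]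
    (A : Set X) (π : X → X) : Set G :=
  {h : G | Metric.hausdorffEDist (π '' (h • A)) A ≠ ⊤}

/-! Put f = hg, or f = h₁g^{n₁}h₂g^{n₂}, and consider the translates of A along the chain u_{i+1} =
u_i h_i g^{n_i} that f generates. By WPD, an element whose translate of A has a large projection to
A must commensurate ⟨g⟩ and so lies in E(g) (`exists_bound_or_mem_commensuratingSet`,
`commensuratingSet_subset_elementaryHull`). Hence consecutive translates have bounded projections to
each other, and the hypothesis on d(p, g^n p) says that the previous and the next translate project
far apart. The Behrstock inequality turns this into a global statement (`IsCoarseConstant.chain`):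
all positive translates f^j A project to A near one point `ap`, all negative ones near another point
`am`.

This separation makes the orbit of `ap` contracting: a point x is sent to f^n ap, where n is the
last index such that x projects to f^n A away from f^n am. A special path crossing from one index to
another passes near every orbit point strictly between (`crossing`). Quasi-geodesicity follows by
counting these points, and the Morse property from contraction.

For WPD, an element h that moves `ap` and f^{2i} ap little carries f^i A to a translate with a long
projection of one fixed special path. Two such translates entered at about the same time differ by a
commensurating element, and only finitely many of those move `ap` a bounded distance
(`exists_finite_base`).

All constants come from a single g₀ with axis A, so they do not depend on g. -/

/-! ### Coarse geometry of projections -/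

section CoarseConstants

variable {X : Type*} [MetricSpace X]

/-- A single constant controlling special paths and all projections with constant `C`. -/
structure IsCoarseConstant (PS : PathSystem X) (C K : ℝ) : Prop where
  one_le : 1 ≤ K
  const_le : C ≤ K
  path_dist : ∀ δ ∈ PS.paths, ∀ s t, dist (δ.toFun s) (δ.toFun t) ≤ K * dist s t + K
  path_param : ∀ δ ∈ PS.paths, ∀ s t, dist s t ≤ K * dist (δ.toFun s) (δ.toFun t) + K
  near : ∀ (A : Set X) (π : X → X), IsProjection PS C A π → ∀ x y, K ≤ dist (π x) (π y) →
    ∀ δ ∈ PS.paths, δ.source = x → δ.target = y →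
      (∃ t, dist (π x) (δ.toFun t) ≤ K) ∧ ∃ t, dist (π y) (δ.toFun t) ≤ K
  lipschitz : ∀ (A : Set X) (π : X → X), IsProjection PS C A π → ∀ x y,
    dist (π x) (π y) ≤ K * dist x y + K
  dist_proj_le : ∀ (A : Set X) (π : X → X), IsProjection PS C A π → ∀ x, ∀ a ∈ A,
    dist x (π x) ≤ K * dist x a + K
  contracting : ∀ (A : Set X) (π : X → X), IsProjection PS C A π → ∀ x y,
    K * dist x y + K < dist x (π x) → dist (π x) (π y) ≤ K
  behrstock : ∀ (A B : Set X) (π ρ : X → X), IsProjection PS C A π → IsProjection PS C B ρ →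
    ∀ x, K ≤ dist (ρ x) (ρ (π x)) → dist (π x) (π (ρ x)) ≤ K

theorem exists_dist_le_of_infDist_le (δ : IntervalPath X) {x : X}
    {C : ℝ} (h : Metric.infDist x δ.image ≤ C) : ∃ t, dist x (δ.toFun t) ≤ C + 1 := by
  have hne : δ.image.Nonempty := ⟨_, ⟨⟨δ.lo, le_refl _, δ.le⟩, rfl⟩⟩
  obtain ⟨_, ⟨t, rfl⟩, ht⟩ := (Metric.infDist_lt_iff hne).1 (show Metric.infDist x δ.image < C + 1 by linarith)
  exact ⟨t, ht.le⟩

/-- The first coarse estimates: paths, and the Lipschitz property of projections. -/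
theorem exists_lipschitz_constant (PS : PathSystem X) {C : ℝ} (hC : 0 ≤ C) :
    ∃ K : ℝ, 1 ≤ K ∧ C + 1 ≤ K ∧
      (∀ δ ∈ PS.paths, ∀ s t, dist (δ.toFun s) (δ.toFun t) ≤ K * dist s t + K) ∧
      (∀ δ ∈ PS.paths, ∀ s t, dist s t ≤ K * dist (δ.toFun s) (δ.toFun t) + K) ∧
      ∀ (A : Set X) (π : X → X), IsProjection PS C A π → ∀ x y,
        dist (π x) (π y) ≤ K * dist x y + K := by
  obtain ⟨μ, hμ, hq⟩ := PS.quasiGeodesic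
  have hμ0 : 0 < μ := by linarith
  have hup : ∀ δ ∈ PS.paths, ∀ s t, dist (δ.toFun s) (δ.toFun t) ≤ μ * dist s t + μ :=
    fun δ hδ s t => (hq δ hδ s t).2
  have hlo : ∀ δ ∈ PS.paths, ∀ s t, dist s t ≤ μ * dist (δ.toFun s) (δ.toFun t) + μ * μ := by
    intro δ hδ s t
    have h := (hq δ hδ s t).1
    have h2 : μ * (μ⁻¹ * dist s t) = dist s t := by field_simp
    nlinarith
  set K : ℝ := 2 * (C + 1) + μ * (μ * μ) + μ + μ * μ with hK
  have h1 : 0 ≤ μ * μ := by positivity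
  have h2 : 0 ≤ μ * (μ * μ) := by positivity
  refine ⟨K, by linarith, by linarith, ?_, ?_, ?_⟩
  · intro δ hδ s t
    have h3 : μ * dist s t ≤ K * dist s t := by gcongr; linarith
    linarith [hup δ hδ s t]
  · intro δ hδ s t
    have h3 : μ * dist (δ.toFun s) (δ.toFun t) ≤ K * dist (δ.toFun s) (δ.toFun t) := by
      gcongr; linarith
    linarith [hlo δ hδ s t]
  · intro A π hπ x y
    have hKd : 0 ≤ K * dist x y := mul_nonneg (by linarith) dist_nonneg
    rcases lt_or_ge (dist (π x) (π y)) C with h | h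
    · linarith
    -- Both projections are near a path whose parameter length is linear in `dist x y`.
    obtain ⟨δ, hδ, hx, hy⟩ := PS.connects x y
    obtain ⟨hn1, hn2⟩ := hπ.near x y h δ hδ hx hy
    obtain ⟨t, ht⟩ := exists_dist_le_of_infDist_le δ hn1
    obtain ⟨t', ht'⟩ := exists_dist_le_of_infDist_le δ hn2
    have hlen := hlo δ hδ ⟨δ.lo, le_refl _, δ.le⟩ ⟨δ.hi, δ.le, le_refl _⟩
    change _ ≤ μ * dist δ.source δ.target + _ at hlen
    rw [hx, hy] at hlen
    have htt : dist t t' ≤ dist (⟨δ.lo, le_refl _, δ.le⟩ : Set.Icc δ.lo δ.hi)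
        ⟨δ.hi, δ.le, le_refl _⟩ := by
      simp only [Subtype.dist_eq, Real.dist_eq]
      rw [abs_sub_comm δ.lo, abs_of_nonneg (sub_nonneg.2 δ.le), abs_le]
      constructor <;> linarith [t.2.1, t.2.2, t'.2.1, t'.2.2]
    have h5 := hup δ hδ t t'
    have h6 : μ * dist t t' ≤ μ * (μ * dist x y + μ * μ) := by gcongr; linarith
    have h7 : dist (π x) (π y) ≤ dist (π x) (δ.toFun t) + dist (δ.toFun t) (δ.toFun t')
      + dist (δ.toFun t') (π y) := dist_triangle4 _ _ _ _
    rw [dist_comm (δ.toFun t') (π y)] at h7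
    have h8 : μ * μ * dist x y ≤ K * dist x y := by gcongr; linarith
    nlinarith

/-- Contraction holds because a path from `x` to `y` with distant projections must come near `π x`,
so `π x` is not much farther from `x` than `y` is. For the Behrstock inequality, a path from `x` to
`π x` must come near `ρ x`, and any point near such a path projects near `π x`. -/
theorem exists_isCoarseConstant (PS : PathSystem X) {C : ℝ} (hC : 0 ≤ C) :
    ∃ K : ℝ, IsCoarseConstant PS C K := by
  obtain ⟨L, h1, hCL, hd, hp, hl⟩ := exists_lipschitz_constant PS hC
  have hL0 : 0 ≤ L := by linarith
  -- A special path from `x` to `π x` that passes near `b`.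
  have key : ∀ (A : Set X) (π : X → X), IsProjection PS C A π → ∀ x b, ∀ δ ∈ PS.paths,
      δ.source = x → δ.target = π x → ∀ t, dist b (δ.toFun t) ≤ L →
      dist (π x) (π b) ≤ L * (L * (L * L + L) + 2 * L) + L * L + 4 * L := by
    intro A π hπ x b δ hδ hx hy t ht
    have hp0 : 0 ≤ L * (L * (L * L + L) + 2 * L) := by positivity
    have hp1 : 0 ≤ L * L := by positivity
    have hzb := hl A π hπ b (δ.toFun t)
    have hzb' : L * dist b (δ.toFun t) ≤ L * L := by gcongr
    rcases lt_or_ge (dist (π x) (π (δ.toFun t))) C with h | h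
    · have := dist_triangle (π x) (π (δ.toFun t)) (π b)
      rw [dist_comm (π (δ.toFun t)) (π b)] at this
      linarith
    -- The path comes near its own end point `π x` at a time `s ≤ t`, so what remains after `s` is
    -- short and `b` is near `π x`.
    · have hsub := PS.subpath_mem δ hδ δ.lo t le_rfl t.2.1 t.2.2
      obtain ⟨s, hs⟩ := exists_dist_le_of_infDist_le _
        (hπ.near x (δ.toFun t) h _ hsub hx rfl).1
      have hsle : (s : ℝ) ≤ t := s.2.2
      have hsL : dist (π x) (δ.toFun ⟨s, s.2.1, s.2.2.trans t.2.2⟩) ≤ L := hs.trans hCL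
      rw [← hy] at hsL
      have h3 := hp δ hδ ⟨δ.hi, δ.le, le_refl _⟩ ⟨s, s.2.1, s.2.2.trans t.2.2⟩
      have h4 := hd δ hδ ⟨δ.hi, δ.le, le_refl _⟩ t
      change _ ≤ L * dist δ.target _ + L at h3
      change dist δ.target _ ≤ _ at h4
      have h5 : dist (⟨δ.hi, δ.le, le_refl _⟩ : Set.Icc δ.lo δ.hi) t ≤
          dist (⟨δ.hi, δ.le, le_refl _⟩ : Set.Icc δ.lo δ.hi) ⟨s, s.2.1, s.2.2.trans t.2.2⟩ := by
        simp only [Subtype.dist_eq, Real.dist_eq]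
        rw [abs_of_nonneg (sub_nonneg.2 t.2.2),
          abs_of_nonneg (sub_nonneg.2 (s.2.2.trans t.2.2))]
        linarith
      have h6 : L * dist δ.target (δ.toFun ⟨s, s.2.1, s.2.2.trans t.2.2⟩) ≤ L * L := by gcongr
      have h7 : L * dist (⟨δ.hi, δ.le, le_refl _⟩ : Set.Icc δ.lo δ.hi) t ≤ L * (L * L + L) := by
        gcongr; linarith
      have h8 : dist (π x) b ≤ L * (L * L + L) + 2 * L := by
        rw [← hy]
        have := dist_triangle δ.target (δ.toFun t) b
        rw [dist_comm (δ.toFun t) b] at this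
        linarith
      have h9 := hl A π hπ (π x) b
      have h10 : L * dist (π x) b ≤ L * (L * (L * L + L) + 2 * L) := by gcongr
      have h11 := hπ.dist_le (π x) (hπ.mem x)
      have h12 := dist_triangle (π x) (π (π x)) (π b)
      rw [dist_comm (π x) (π (π x))] at h12
      linarith
  set K : ℝ := L * (L * (L * L + L) + 2 * L) + L * L + 4 * L with hK
  have hp0 : 0 ≤ L * (L * (L * L + L) + 2 * L) := by positivity
  have hp1 : 0 ≤ L * L := by positivity
  have hp2 : L * L * L ≤ K := by
    have : 0 ≤ L * L * L := by positivity
    have : 0 ≤ L * L * L * L := by positivity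
    nlinarith
  have hnear : ∀ (A : Set X) (π : X → X), IsProjection PS C A π → ∀ x y, C ≤ dist (π x) (π y) →
      ∀ δ ∈ PS.paths, δ.source = x → δ.target = y →
      (∃ t, dist (π x) (δ.toFun t) ≤ L) ∧ ∃ t, dist (π y) (δ.toFun t) ≤ L := by
    intro A π hπ x y h δ hδ hx hy
    obtain ⟨hn1, hn2⟩ := hπ.near x y h δ hδ hx hy
    obtain ⟨t, ht⟩ := exists_dist_le_of_infDist_le δ hn1
    obtain ⟨t', ht'⟩ := exists_dist_le_of_infDist_le δ hn2
    exact ⟨⟨t, by linarith⟩, ⟨t', by linarith⟩⟩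
  have hLK : L ≤ K := by linarith
  refine ⟨K, by linarith, by linarith, ?_, ?_, ?_, ?_, ?_, ?_, ?_⟩
  · intro δ hδ s t
    have h3 : L * dist s t ≤ K * dist s t := by gcongr
    linarith [hd δ hδ s t]
  · intro δ hδ s t
    have h3 : L * dist (δ.toFun s) (δ.toFun t) ≤ K * dist (δ.toFun s) (δ.toFun t) := by
      gcongr
    linarith [hp δ hδ s t]
  · intro A π hπ x y h δ hδ hx hy
    obtain ⟨⟨t, ht⟩, ⟨t', ht'⟩⟩ := hnear A π hπ x y (by linarith) δ hδ hx hy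
    exact ⟨⟨t, by linarith⟩, ⟨t', by linarith⟩⟩
  · intro A π hπ x y
    have h3 : L * dist x y ≤ K * dist x y := by gcongr
    linarith [hl A π hπ x y]
  · intro A π hπ x a ha
    have h3 : (L + 1) * dist x a ≤ K * dist x a := by gcongr; linarith
    have h4 := dist_triangle4 x a (π a) (π x)
    have h5 := hl A π hπ a x
    have h6 := hπ.dist_le a ha
    rw [dist_comm a x] at h5
    rw [dist_comm (π a) a] at h6
    linarith
  · intro A π hπ x y h
    by_contra! hcon
    obtain ⟨δ, hδ, hx, hy⟩ := PS.connects x y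
    obtain ⟨⟨t, ht⟩, -⟩ := hnear A π hπ x y (by linarith) δ hδ hx hy
    have h3 := hp δ hδ ⟨δ.lo, le_refl _, δ.le⟩ ⟨δ.hi, δ.le, le_refl _⟩
    have h4 := hd δ hδ ⟨δ.lo, le_refl _, δ.le⟩ t
    change _ ≤ L * dist δ.source δ.target + _ at h3
    change dist δ.source _ ≤ _ at h4
    rw [hx, hy] at h3
    rw [hx] at h4
    have htt : dist (⟨δ.lo, le_refl _, δ.le⟩ : Set.Icc δ.lo δ.hi) t ≤
        dist (⟨δ.lo, le_refl _, δ.le⟩ : Set.Icc δ.lo δ.hi) ⟨δ.hi, δ.le, le_refl _⟩ := by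
      simp only [Subtype.dist_eq, Real.dist_eq]
      rw [abs_sub_comm δ.lo, abs_sub_comm δ.lo, abs_of_nonneg (sub_nonneg.2 δ.le),
        abs_of_nonneg (sub_nonneg.2 t.2.1)]
      linarith [t.2.2]
    have h5 : L * dist (⟨δ.lo, le_refl _, δ.le⟩ : Set.Icc δ.lo δ.hi) t ≤
      L * (L * dist x y + L) := by gcongr; linarith
    have h6 : L * L * dist x y ≤ K * dist x y := by gcongr; linarith
    have h7 := dist_triangle x (δ.toFun t) (π x)
    rw [dist_comm (δ.toFun t) (π x)] at h7
    nlinarith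
  · intro A B π ρ hπ hρ x h
    obtain ⟨δ, hδ, hx, hy⟩ := PS.connects x (π x)
    obtain ⟨⟨t, ht⟩, -⟩ := hnear B ρ hρ x (π x) (by linarith) δ hδ hx hy
    exact key A π hπ x (ρ x) δ hδ hx hy t ht

theorem IsCoarseConstant.nonneg {PS : PathSystem X} {C K : ℝ} (hK : IsCoarseConstant PS C K) :
    0 ≤ K := zero_le_one.trans hK.one_le

theorem IsCoarseConstant.dist_le {PS : PathSystem X} {C K : ℝ} (hK : IsCoarseConstant PS C K)
    {A : Set X} {π : X → X} (hπ : IsProjection PS C A π) {a : X} (ha : a ∈ A) :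
    dist (π a) a ≤ K := (hπ.dist_le a ha).trans hK.const_le

/-- Two projections on the same set with the same constant are close to each other. -/
theorem IsCoarseConstant.dist_proj_proj_le {PS : PathSystem X} {C K : ℝ}
    (hK : IsCoarseConstant PS C K) {A : Set X} {π ρ : X → X} (hπ : IsProjection PS C A π)
    (hρ : IsProjection PS C A ρ) (x : X) : dist (π x) (ρ x) ≤ 2 * K := by
  -- Behrstock with both sets equal to `A`; each projection almost fixes the values of the other.
  rcases lt_or_ge (dist (ρ x) (ρ (π x))) K with h | h
  · have h1 := hK.dist_le hρ (hπ.mem x)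
    have h2 := dist_triangle (ρ x) (ρ (π x)) (π x)
    rw [dist_comm]
    linarith
  · have h1 := hK.behrstock A A π ρ hπ hρ x h
    have h2 := hK.dist_le hπ (hρ.mem x)
    have h3 := dist_triangle (π x) (π (ρ x)) (ρ x)
    linarith

/-- The length of the parameter interval of a special path. -/
theorem IsCoarseConstant.length_le {PS : PathSystem X} {C K : ℝ} (hK : IsCoarseConstant PS C K)
    {δ : IntervalPath X} (hδ : δ ∈ PS.paths) :
    δ.hi - δ.lo ≤ K * dist δ.source δ.target + K := by
  have h := hK.path_param δ hδ ⟨δ.lo, le_refl _, δ.le⟩ ⟨δ.hi, δ.le, le_refl _⟩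
  simp only [Subtype.dist_eq, Real.dist_eq] at h
  rw [abs_sub_comm, abs_of_nonneg (sub_nonneg.2 δ.le)] at h
  exact h

/-- Points of a special path are close to its end point. -/
theorem IsCoarseConstant.dist_target_le {PS : PathSystem X} {C K : ℝ}
    (hK : IsCoarseConstant PS C K) {δ : IntervalPath X} (hδ : δ ∈ PS.paths) (t) :
    dist (δ.toFun t) δ.target ≤ K * (K * dist δ.source δ.target + K) + K := by
  have h := hK.path_dist δ hδ t ⟨δ.hi, δ.le, le_refl _⟩
  have h2 : dist t (⟨δ.hi, δ.le, le_refl _⟩ : Set.Icc δ.lo δ.hi) ≤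
      K * dist δ.source δ.target + K := by
    refine le_trans ?_ (hK.length_le hδ)
    simp only [Subtype.dist_eq, Real.dist_eq]
    rw [abs_sub_comm, abs_of_nonneg (sub_nonneg.2 t.2.2)]
    linarith [t.2.1]
  have := mul_le_mul_of_nonneg_left h2 hK.nonneg
  exact h.trans (by linarith)

/-- The translate of a projection is a projection on the translated set. -/
theorem IsProjection.smul {G : Type*} [Group G] [MulAction G X] [IsIsometricSMul G X]
    {PS : PathSystem X} (hPS : PS.IsInvariant G) {C : ℝ} {A : Set X} {π : X → X}
    (hπ : IsProjection PS C A π) (u : G) :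
    IsProjection PS C (u • A) (fun x => u • π (u⁻¹ • x)) where
  mem x := Set.smul_mem_smul_set (hπ.mem _)
  dist_le := by
    rintro _ ⟨a, ha, rfl⟩
    simp only [inv_smul_smul, dist_smul]
    exact hπ.dist_le a ha
  near := by
    intro x y h δ hδ hx hy
    rw [dist_smul] at h
    have h1 := hπ.near (u⁻¹ • x) (u⁻¹ • y) h _ (hPS u⁻¹ δ hδ)
      (by rw [← hx]; rfl) (by rw [← hy]; rfl)
    have him : δ.image = (fun x => u • x) '' (δ.map (fun x => u⁻¹ • x)).image := by
      simp only [IntervalPath.image, IntervalPath.map, ← Set.range_comp, Function.comp_def,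
        smul_inv_smul]
    have hi := isometry_smul X u
    rw [him]
    rw [Metric.infDist_image hi, Metric.infDist_image hi]
    exact h1

end CoarseConstants

/-! ### Contracting sets are Morse -/

section Morse

variable {X : Type*} [MetricSpace X]

theorem dist_le_mul_of_step_le {z : ℕ → X} {S : ℝ} {n : ℕ}
    (h : ∀ j < n, dist (z j) (z (j + 1)) ≤ S) : dist (z 0) (z n) ≤ n * S := by
  induction n with
  | zero => simp
  | succ n ih =>
    have h1 := ih fun j hj => h j (by omega)
    have h2 := h n (by omega)
    have h3 := dist_triangle (z 0) (z n) (z (n + 1))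
    push_cast
    linarith

/-- A sequence that moves at definite speed in steps of bounded size, and starts and ends near `A`,
stays near `A`. -/
theorem IsCoarseConstant.dist_proj_le_of_sequence {PS : PathSystem X} {C K : ℝ}
    (hK : IsCoarseConstant PS C K) {A : Set X} {π : X → X} (hπ : IsProjection PS C A π)
    {y : ℤ → X} {a b k : ℤ} (hak : a ≤ k) (hkb : k ≤ b) {S c T : ℝ} (hS : 0 ≤ S)
    (hT : K * S + K ≤ T)
    (hstep : ∀ i, a ≤ i → i < b → dist (y i) (y (i + 1)) ≤ S)
    (hspeed : ∀ i j, a ≤ i → i ≤ j → j ≤ b → (K + 1) * ((j : ℝ) - i) - c ≤ dist (y i) (y j))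
    (ha : dist (y a) (π (y a)) ≤ T) (hb : dist (y b) (π (y b)) ≤ T) :
    dist (y k) (π (y k)) ≤ T + (c + 2 * T) * (S + K) := by
  classical
  have hn : ∃ n : ℕ, dist (y (k + n)) (π (y (k + n))) ≤ T :=
    ⟨(b - k).toNat, by rw [Int.toNat_of_nonneg (by omega)]; simpa using hb⟩
  have hm : ∃ m : ℕ, dist (y (k - m)) (π (y (k - m))) ≤ T :=
    ⟨(k - a).toNat, by rw [Int.toNat_of_nonneg (by omega)]; simpa using ha⟩
  -- `n` and `m` are the first returns to the `T`-neighbourhood of `A`, forwards and backwards from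
  -- `k`. Outside it each step moves the projection by at most `K` while the sequence advances at
  -- speed `K + 1`, so `n + m ≤ c + 2 * T`.
  set n := Nat.find hn with hndef
  set m := Nat.find hm with hmdef
  have hnb : k + n ≤ b := by
    have : n ≤ (b - k).toNat := Nat.find_min' hn (by
      rw [Int.toNat_of_nonneg (by omega)]; simpa using hb)
    omega
  have hma : a ≤ k - m := by
    have : m ≤ (k - a).toNat := Nat.find_min' hm (by
      rw [Int.toNat_of_nonneg (by omega)]; simpa using ha)
    omega
  have hn1 : ∀ j < n, T < dist (y (k + j)) (π (y (k + j))) :=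
    fun j hj => not_le.1 (Nat.find_min hn hj)
  have hm1 : ∀ j < m, T < dist (y (k - j)) (π (y (k - j))) :=
    fun j hj => not_le.1 (Nat.find_min hm hj)
  have hcon : ∀ x z, T < dist x (π x) → dist x z ≤ S → dist (π x) (π z) ≤ K := by
    intro x z hx hz
    refine hK.contracting A π hπ x z ?_
    have := mul_le_mul_of_nonneg_left hz hK.nonneg
    linarith
  have sn : ∀ j < n, dist (y (k + j)) (y (k + (j + 1 : ℕ))) ≤ S := by
    intro j hj
    have := hstep (k + j) (by omega) (by omega)
    rwa [add_assoc] at this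
  have sm : ∀ j < m, dist (y (k - j)) (y (k - (j + 1 : ℕ))) ≤ S := by
    intro j hj
    have := hstep (k - (j + 1 : ℕ)) (by omega) (by omega)
    rw [dist_comm]
    convert this using 3
    push_cast; ring
  have pn := dist_le_mul_of_step_le (z := fun j : ℕ => π (y (k + j))) (S := K) (n := n)
    fun j hj => hcon _ _ (hn1 j hj) (sn j hj)
  have pm := dist_le_mul_of_step_le (z := fun j : ℕ => π (y (k - j))) (S := K) (n := m)
    fun j hj => hcon _ _ (hm1 j hj) (sm j hj)
  have qn := dist_le_mul_of_step_le (z := fun j : ℕ => y (k + j)) (S := S) (n := n) sn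
  have hns := Nat.find_spec hn
  have hms := Nat.find_spec hm
  rw [← hndef] at hns
  rw [← hmdef] at hms
  simp only [Nat.cast_zero, add_zero, sub_zero] at pn pm qn
  have hsp := hspeed (k - m) (k + n) hma (by omega) hnb
  push_cast at hsp
  have t1 := dist_triangle4 (y (k - m)) (π (y (k - m))) (π (y k)) (π (y (k + n)))
  have t2 := dist_triangle (y (k - m)) (π (y (k + n))) (y (k + n))
  have t3 := dist_triangle4 (y k) (y (k + n)) (π (y (k + n))) (π (y k))
  rw [dist_comm (π (y (k - m)))] at t1
  rw [dist_comm (π (y (k + n)))] at t2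
  rw [dist_comm (π (y (k + n)))] at t3
  have hnm : (n : ℝ) + m ≤ c + 2 * T := by nlinarith
  have hm0 : (0 : ℝ) ≤ m := Nat.cast_nonneg m
  have : (n : ℝ) * (S + K) ≤ (c + 2 * T) * (S + K) :=
    mul_le_mul_of_nonneg_right (by linarith) (by linarith [hK.nonneg])
  nlinarith

/-- Contracting sets are Morse. -/
theorem IsCoarseConstant.exists_morse_constant {PS : PathSystem X} {C K : ℝ}
    (hK : IsCoarseConstant PS C K) {μ c : ℝ} (hμ : 1 ≤ μ) (hc : 0 ≤ c) (r : ℝ) :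
    ∃ M : ℝ, ∀ (A : Set X) (π : X → X), IsProjection PS C A π →
      ∀ γ : IntervalPath X, IsQuasiGeodesic μ c γ.toFun →
      dist γ.source (π γ.source) ≤ r → dist γ.target (π γ.target) ≤ r →
      ∀ t, dist (γ.toFun t) (π (γ.toFun t)) ≤ M := by
  have hK1 := hK.one_le
  -- Sampling gap chosen so that the sampled sequence has speed `K + 1`.
  set τ : ℝ := μ * (K + 1) with hτ
  have hτ0 : 0 < τ := by positivity
  set S : ℝ := μ * τ + c with hS
  set T : ℝ := max r (K * S + K) with hT
  refine ⟨T + ((2 * (K + 1) + c) + 2 * T) * (S + K), ?_⟩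
  intro A π hπ γ hγ hs ht t
  -- Sample times are centred at `t` and clamped to the interval. Clamping loses at most `τ` at each
  -- end, whence the term `2 * (K + 1)`.
  set cl : ℤ → Set.Icc γ.lo γ.hi := fun i => Set.projIcc γ.lo γ.hi γ.le ((t : ℝ) + (i : ℝ) * τ) with hcl
  set b : ℤ := ⌈(γ.hi - t) / τ⌉ with hb
  set a : ℤ := -⌈(t - γ.lo) / τ⌉ with ha
  have hb1 : γ.hi ≤ (t : ℝ) + (b : ℝ) * τ := by
    have := (div_le_iff₀ hτ0).1 (Int.le_ceil ((γ.hi - t) / τ))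
    linarith
  have hb2 : (t : ℝ) + (b : ℝ) * τ ≤ γ.hi + τ := by
    have := (lt_div_iff₀ hτ0).1 (sub_lt_iff_lt_add.2 (Int.ceil_lt_add_one ((γ.hi - t) / τ)))
    rw [← hb] at this
    linarith
  have ha1 : (t : ℝ) + (a : ℝ) * τ ≤ γ.lo := by
    have := (div_le_iff₀ hτ0).1 (Int.le_ceil ((t - γ.lo) / τ))
    rw [ha]; push_cast; linarith
  have ha2 : γ.lo - τ ≤ (t : ℝ) + (a : ℝ) * τ := by
    have := (lt_div_iff₀ hτ0).1 (sub_lt_iff_lt_add.2 (Int.ceil_lt_add_one ((t - γ.lo) / τ)))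
    rw [ha]; push_cast; linarith
  have hcl0 : cl 0 = t := by
    simp [hcl]
  have hclb : cl b = ⟨γ.hi, γ.le, le_refl _⟩ := Set.projIcc_of_right_le _ hb1
  have hcla : cl a = ⟨γ.lo, le_refl _, γ.le⟩ := Set.projIcc_of_le_left _ ha1
  have key := hK.dist_proj_le_of_sequence hπ (y := fun i => γ.toFun (cl i)) (a := a) (b := b)
    (k := 0) (S := S) (T := T) (c := 2 * (K + 1) + c)
    (by rw [ha, neg_nonpos]; exact Int.ceil_nonneg (div_nonneg (by linarith [t.2.1]) hτ0.le))
    (Int.ceil_nonneg (div_nonneg (by linarith [t.2.2]) hτ0.le)) (by positivity)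
    (le_max_right _ _) ?_ ?_ ?_ ?_
  · simpa [hcl0] using key
  · intro i _ _
    refine (hγ _ _).2.trans ?_
    have : dist (cl i) (cl (i + 1)) ≤ τ := by
      simp only [hcl, Subtype.dist_eq, Real.dist_eq]
      refine (Set.abs_projIcc_sub_projIcc γ.le).trans ?_
      push_cast
      rw [show (t : ℝ) + i * τ - (t + (i + 1) * τ) = -τ by ring, abs_neg, abs_of_pos hτ0]
    have := mul_le_mul_of_nonneg_left this (by linarith : 0 ≤ μ)
    linarith
  · intro i j hai hij hjb
    refine le_trans ?_ (hγ _ _).1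
    have hlow : ((j : ℝ) - i) * τ - 2 * τ ≤ dist (cl i) (cl j) := by
      have h1 : γ.lo - τ ≤ (t : ℝ) + (i : ℝ) * τ := by
        have : (a : ℝ) * τ ≤ i * τ := by gcongr
        linarith
      have h2 : (t : ℝ) + (j : ℝ) * τ ≤ γ.hi + τ := by
        have : (j : ℝ) * τ ≤ b * τ := by gcongr
        linarith
      simp only [hcl, Subtype.dist_eq, Real.dist_eq, Set.coe_projIcc]
      rw [abs_sub_comm]
      refine le_trans ?_ (le_abs_self _)
      have h3 : (t : ℝ) + (j : ℝ) * τ - τ ≤ max γ.lo (min γ.hi ((t : ℝ) + (j : ℝ) * τ)) :=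
        le_max_of_le_right (le_min (by linarith) (by linarith))
      have h4 : max γ.lo (min γ.hi ((t : ℝ) + (i : ℝ) * τ)) ≤ (t : ℝ) + (i : ℝ) * τ + τ :=
        max_le (by linarith) ((min_le_right _ _).trans (by linarith))
      linarith
    have h5 := mul_le_mul_of_nonneg_left hlow (by positivity : 0 ≤ μ⁻¹)
    have h6 : μ⁻¹ * (((j : ℝ) - i) * τ - 2 * τ) = (K + 1) * ((j : ℝ) - i) - 2 * (K + 1) := by
      rw [hτ]; field_simp
    linarith
  · simp only [hcla]; exact hs.trans (le_max_left _ _)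
  · simp only [hclb]; exact ht.trans (le_max_left _ _)

/-- Contracting sets are Morse: the version for sequences. -/
theorem IsCoarseConstant.exists_morse_constant_int {PS : PathSystem X} {C K : ℝ}
    (hK : IsCoarseConstant PS C K) {ν : ℝ} (hν : 1 ≤ ν) (r : ℝ) :
    ∃ M : ℝ, ∀ (A : Set X) (π : X → X), IsProjection PS C A π →
      ∀ y : ℤ → X, IsQuasiGeodesic ν ν y → ∀ a b i : ℤ, a ≤ i → i ≤ b →
      dist (y a) (π (y a)) ≤ r → dist (y b) (π (y b)) ≤ r → dist (y i) (π (y i)) ≤ M := by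
  obtain ⟨M, hM⟩ := hK.exists_morse_constant hν (by positivity : 0 ≤ 2 * ν) r
  refine ⟨M, fun A π hπ y hy a b i hai hib ha hb => ?_⟩
  have hab : (a : ℝ) ≤ b := by exact_mod_cast hai.trans hib
  -- Rounding changes parameter distances by at most 1, so the additive constant grows from `ν` to
  -- `2 * ν`.
  have h := hM A π hπ ⟨a, b, hab, fun t => y ⌊(t : ℝ)⌋⟩ ?_
    (by simpa [IntervalPath.source] using ha) (by simpa [IntervalPath.target] using hb)
    ⟨i, Int.cast_le.2 hai, Int.cast_le.2 hib⟩
  · simpa using h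
  · intro s t
    obtain ⟨h1, h2⟩ := hy ⌊(s : ℝ)⌋ ⌊(t : ℝ)⌋
    have hd1 : dist ⌊(s : ℝ)⌋ ⌊(t : ℝ)⌋ ≤ dist s t + 1 := by
      simp only [Int.dist_eq, Subtype.dist_eq, Real.dist_eq]
      have e1 := Int.floor_le (s : ℝ)
      have e2 := Int.lt_floor_add_one (s : ℝ)
      have e3 := Int.floor_le (t : ℝ)
      have e4 := Int.lt_floor_add_one (t : ℝ)
      have e5 := abs_le.1 (le_refl |(s : ℝ) - t|)
      rw [abs_le]
      constructor <;> linarith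
    have hd2 : dist s t - 1 ≤ dist ⌊(s : ℝ)⌋ ⌊(t : ℝ)⌋ := by
      simp only [Int.dist_eq, Subtype.dist_eq, Real.dist_eq]
      have e1 := Int.floor_le (s : ℝ)
      have e2 := Int.lt_floor_add_one (s : ℝ)
      have e3 := Int.floor_le (t : ℝ)
      have e4 := Int.lt_floor_add_one (t : ℝ)
      have e5 := abs_le.1 (le_refl |(⌊(s : ℝ)⌋ : ℝ) - ⌊(t : ℝ)⌋|)
      rw [sub_le_iff_le_add, abs_le]
      constructor <;> linarith
    have hi : ν⁻¹ ≤ 1 := inv_le_one_of_one_le₀ hν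
    have hi0 : 0 ≤ ν⁻¹ := by positivity
    constructor
    · have := mul_le_mul_of_nonneg_left hd2 hi0
      refine le_trans ?_ h1
      linarith
    · have := mul_le_mul_of_nonneg_left hd1 (by linarith : 0 ≤ ν)
      refine h2.trans ?_
      linarith

end Morse

/-! ### WPD and commensurating elements -/

section Commensurating

/-- The elements that conjugate some nontrivial power of `g` to another one. -/
def commensuratingSet {G : Type*} [Group G] (g : G) : Set G :=
  {h : G | ∃ a b : ℤ, a ≠ 0 ∧ b ≠ 0 ∧ h * g ^ a = g ^ b * h}

theorem inv_mem_commensuratingSet {G : Type*} [Group G] {g h : G}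
    (hh : h ∈ commensuratingSet g) : h⁻¹ ∈ commensuratingSet g := by
  obtain ⟨a, b, ha, hb, h1⟩ := hh
  exact ⟨b, a, hb, ha, by rw [inv_mul_eq_iff_eq_mul, ← mul_assoc, h1, mul_inv_cancel_right]⟩

theorem mul_zpow_mul_eq {G : Type*} [Group G] {g h : G} {a b : ℤ} (hab : h * g ^ a = g ^ b * h)
    (k : ℤ) : h * g ^ (a * k) = g ^ (b * k) * h := by
  rw [zpow_mul, zpow_mul]
  exact (show SemiconjBy h (g ^ a) (g ^ b) from hab).zpow_right k

variable {G X : Type*} [Group G] [MetricSpace X] [MulAction G X]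

theorem IsQuasiGeodesic.abs_le {ν : ℝ} (hν : 1 ≤ ν) {y : ℤ → X} (hy : IsQuasiGeodesic ν ν y)
    {i j : ℤ} {Q : ℝ} (h : dist (y i) (y j) ≤ Q) : |(i : ℝ) - j| ≤ ν * (Q + ν) := by
  have h1 := (hy i j).1
  rw [Int.dist_eq] at h1
  have h2 : |(i : ℝ) - j| = ν * (ν⁻¹ * |(i : ℝ) - j|) := by field_simp
  rw [h2]
  exact mul_le_mul_of_nonneg_left (by linarith) (by linarith)

theorem IsCoboundedInvariant.zpow_smul_mem {g : G} {A : Set X} (hA : IsCoboundedInvariant g A)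
    (n : ℤ) {x : X} (hx : x ∈ A) : g ^ n • x ∈ A := by
  have h : g ^ n ∈ MulAction.stabilizer G A := Subgroup.zpow_mem _ hA.invariant n
  have h2 : g ^ n • A = A := h
  rw [← h2]
  exact Set.smul_mem_smul_set hx

theorem IsCoboundedInvariant.zpow_smul_set {g : G} {A : Set X} (hA : IsCoboundedInvariant g A)
    (n : ℤ) : g ^ n • A = A := by
  have h : g ^ n ∈ MulAction.stabilizer G A := Subgroup.zpow_mem _ hA.invariant n
  exact h

variable [IsIsometricSMul G X]

theorem IsQuasiGeodesic.smul {ν : ℝ} {y : ℤ → X} (hy : IsQuasiGeodesic ν ν y) (h : G) :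
    IsQuasiGeodesic ν ν (fun i => h • y i) := by
  intro i j
  simp only [dist_smul]
  exact hy i j

/-- A strengthening of the WPD property. -/
theorem IsWPD.exists_finite {g : G} (hg : IsWPD X g) (q : X) {M : ℝ} (hM : 0 ≤ M) :
    ∃ N : ℕ, {e : G | dist q (e • q) ≤ M ∧
      ∃ m : ℤ, dist ((e * g ^ N) • q) (g ^ m • q) ≤ M}.Finite := by
  obtain ⟨N, hN⟩ := hg.2 (2 * M) (by linarith) q
  obtain ⟨ν, hν, hq⟩ := (hg.1 q).1
  refine ⟨N, ?_⟩
  -- The orbit is a quasi-geodesic, so only finitely many `m` can occur.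
  set n : ℤ := ⌈ν * (2 * M + dist q (g ^ N • q) + ν)⌉ with hn
  refine Set.Finite.subset (s := ⋃ m ∈ Set.Icc (-n) n,
    {e : G | dist q (e • q) ≤ M ∧ dist ((e * g ^ N) • q) (g ^ m • q) ≤ M}) ?_ ?_
  · refine (Set.finite_Icc _ _).biUnion fun m _ => ?_
    rcases Set.eq_empty_or_nonempty
      {e : G | dist q (e • q) ≤ M ∧ dist ((e * g ^ N) • q) (g ^ m • q) ≤ M} with h | ⟨e₀, h1, h2⟩
    · rw [h]; exact Set.finite_empty
    -- For fixed `m`, `e₀⁻¹ * e` moves both `q` and `g ^ N • q` by at most `2 * M`.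
    refine (hN.image (e₀ * ·)).subset ?_
    rintro e ⟨h3, h4⟩
    refine ⟨e₀⁻¹ * e, ⟨?_, ?_⟩, by simp⟩
    · rw [← dist_smul e₀, smul_smul, mul_inv_cancel_left]
      linarith [dist_triangle_left (e₀ • q) (e • q) q]
    · rw [← dist_smul e₀, smul_smul, smul_smul, mul_assoc, mul_inv_cancel_left]
      linarith [dist_triangle_right ((e * g ^ N) • q) ((e₀ * g ^ N) • q) (g ^ m • q)]
  · rintro e ⟨h1, m, h2⟩
    simp only [Set.mem_iUnion]
    refine ⟨m, ?_, h1, h2⟩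
    have h3 : dist (g ^ (0 : ℤ) • q) (g ^ m • q) ≤ 2 * M + dist q (g ^ N • q) := by
      have h4 := dist_triangle4 q (e • q) ((e * g ^ N) • q) (g ^ m • q)
      rw [mul_smul, dist_smul, ← mul_smul] at h4
      rw [zpow_zero, one_smul]
      linarith
    have h5 := hq.abs_le hν h3
    have h6 := h5.trans (Int.le_ceil _)
    rw [← hn, Int.cast_zero, zero_sub, abs_neg, _root_.abs_le] at h6
    exact ⟨by exact_mod_cast h6.1, by exact_mod_cast h6.2⟩

/-- If `e` commensurates and moves `q` little, then `e • g ^ (a * k) • q` stays near `A` for all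
`k`. The Morse property fills in the other exponents, in particular the one at which WPD gives
finiteness. -/
theorem finite_commensuratingSet_inter {PS : PathSystem X} {C K : ℝ}
    (hK : IsCoarseConstant PS C K) {g : G} (hg : IsWPD X g) {A : Set X}
    (hA : IsCoboundedInvariant g A) {π : X → X} (hπ : IsProjection PS C A π) {q : X} (hq : q ∈ A)
    (R : ℝ) : {e ∈ commensuratingSet g | dist q (e • q) ≤ R}.Finite := by
  rcases lt_or_ge R 0 with hR | hR
  · convert Set.finite_empty
    ext e
    simp only [Set.mem_ofPred_eq, Set.mem_empty_iff_false, iff_false, not_and, not_le]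
    exact fun _ => hR.trans_le dist_nonneg
  obtain ⟨ν, hν, hqg⟩ := (hg.1 q).1
  obtain ⟨M, hM⟩ := hK.exists_morse_constant_int hν (K * R + K)
  obtain ⟨Rc, hRc⟩ := hA.cobounded
  obtain ⟨N, hN⟩ := hg.exists_finite q (M := max R (M + Rc)) (hR.trans (le_max_left _ _))
  refine hN.subset ?_
  rintro e ⟨⟨a, b, ha, -, hab⟩, he⟩
  refine ⟨he.trans (le_max_left _ _), ?_⟩
  have hend : ∀ k : ℤ, dist (e • g ^ (a * k) • q) (π (e • g ^ (a * k) • q)) ≤ K * R + K := by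
    intro k
    have h1 := hK.dist_proj_le A π hπ (e • g ^ (a * k) • q) (g ^ (b * k) • q)
      (hA.zpow_smul_mem _ hq)
    rw [smul_smul, mul_zpow_mul_eq hab, mul_smul, dist_smul, dist_comm (e • q) q] at h1
    have := mul_le_mul_of_nonneg_left he hK.nonneg
    rw [smul_smul, mul_zpow_mul_eq hab, mul_smul]
    linarith
  -- This places `N` between two multiples of `a`, namely `0` and `|a| * N`.
  have hNle : (N : ℤ) ≤ |a| * N := by
    have : 1 ≤ |a| := Int.one_le_abs ha
    nlinarith [Int.natCast_nonneg N]
  have hMN : dist (e • g ^ (N : ℤ) • q) (π (e • g ^ (N : ℤ) • q)) ≤ M := by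
    rcases abs_choice a with h | h
    · refine hM A π hπ _ (hqg.smul e) (a * 0) (a * N) N (by simp) (by rwa [h] at hNle)
        (hend _) (hend _)
    · refine hM A π hπ _ (hqg.smul e) (a * 0) (a * (-N)) N (by simp) ?_ (hend _) (hend _)
      rw [h] at hNle
      linarith
  obtain ⟨m, hm⟩ := hRc q hq _ (hπ.mem (e • g ^ (N : ℤ) • q))
  refine ⟨m, le_trans ?_ (le_max_right _ _)⟩
  have := dist_triangle_right (e • g ^ (N : ℤ) • q) (g ^ m • q) (π (e • g ^ (N : ℤ) • q))
  rw [mul_smul, ← zpow_natCast]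
  linarith

/-- Either the projection of `hA` to `A` is uniformly bounded, or `h` commensurates `⟨g⟩`. -/
theorem exists_bound_or_mem_commensuratingSet {PS : PathSystem X} (hPS : PS.IsInvariant G)
    {C K : ℝ} (hK : IsCoarseConstant PS C K) {g : G} (hfin : ¬ IsOfFinOrder g) (hg : IsWPD X g)
    {A : Set X} (hA : IsCoboundedInvariant g A) {π : X → X} (hπ : IsProjection PS C A π) :
    ∃ B : ℝ, ∀ h : G, h ∉ commensuratingSet g → ∀ y ∈ A, ∀ z ∈ A,
      dist (π (h • y)) (π (h • z)) ≤ B := by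
  obtain ⟨q, hq⟩ := hA.nonempty
  obtain ⟨ν, hν, hqg⟩ := (hg.1 q).1
  obtain ⟨M₀, hM₀⟩ := hK.exists_morse_constant hK.one_le hK.nonneg K
  obtain ⟨Rc, hRc⟩ := hA.cobounded
  set K' : ℝ := K + M₀ + Rc with hK'
  obtain ⟨M, hM⟩ := hK.exists_morse_constant_int hν (K * K' + K)
  set M' : ℝ := max 0 (M + Rc) with hM'
  obtain ⟨N, hN⟩ := hg.exists_finite q (M := M') (le_max_left _ _)
  set F := {e : G | dist q (e • q) ≤ M' ∧
      ∃ m : ℤ, dist ((e * g ^ N) • q) (g ^ m • q) ≤ M'} with hF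
  -- A larger projection makes `A` and `h • A` fellow-travel over at least `N + F.ncard + 1`
  -- exponents of `g`, enough for a pigeonhole in `F`.
  refine ⟨max K (2 * K' + ν * (N + F.ncard + 1) + ν), fun h hh y hy z hz => ?_⟩
  by_contra! hB
  apply hh
  have hBK : K ≤ dist (π (h • y)) (π (h • z)) := (le_max_left _ _).trans hB.le
  have hB2 := (le_max_right _ _).trans_lt hB
  obtain ⟨δ, hδ, hsrc, htgt⟩ := PS.connects (h • y) (h • z)
  have hρ := hπ.smul hPS h
  have hδq : IsQuasiGeodesic K K δ.toFun := by
    intro s t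
    refine ⟨?_, hK.path_dist δ hδ s t⟩
    have h1 := hK.path_param δ hδ s t
    have hK0 : 0 < K := by linarith [hK.one_le]
    have h2 : K⁻¹ * dist s t ≤ K⁻¹ * (K * dist (δ.toFun s) (δ.toFun t) + K) := by gcongr
    have h3 : K⁻¹ * (K * dist (δ.toFun s) (δ.toFun t) + K) = dist (δ.toFun s) (δ.toFun t) + 1 := by
      field_simp
    linarith [hK.one_le]
  have hend : ∀ a ∈ A, dist (h • a) (h • π (h⁻¹ • h • a)) ≤ K := by
    intro a ha
    rw [inv_smul_smul, dist_smul, dist_comm]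
    exact hK.dist_le hπ ha
  have hm : ∀ t, ∀ x, dist x (δ.toFun t) ≤ K → ∃ m : ℤ, dist x (h • g ^ m • q) ≤ K' := by
    intro t x hx
    have h1 := hM₀ _ _ hρ δ hδq (by rw [hsrc]; exact hend y hy) (by rw [htgt]; exact hend z hz) t
    obtain ⟨m, hm⟩ := hRc q hq _ (hπ.mem (h⁻¹ • δ.toFun t))
    refine ⟨m, ?_⟩
    have h2 := dist_triangle4 x (δ.toFun t) (h • π (h⁻¹ • δ.toFun t)) (h • g ^ m • q)
    rw [dist_smul, dist_comm (π _)] at h2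
    linarith
  obtain ⟨⟨t₁, ht₁⟩, ⟨t₂, ht₂⟩⟩ := hK.near A π hπ _ _ hBK δ hδ hsrc htgt
  obtain ⟨m₁, hm₁⟩ := hm t₁ _ ht₁
  obtain ⟨m₂, hm₂⟩ := hm t₂ _ ht₂
  have hend2 : ∀ (m : ℤ) (a : X), a ∈ A → dist a (h • g ^ m • q) ≤ K' →
      dist (h • g ^ m • q) (π (h • g ^ m • q)) ≤ K * K' + K := by
    intro m a ha hd
    have h1 := hK.dist_proj_le A π hπ (h • g ^ m • q) a ha
    rw [dist_comm (h • g ^ m • q) a] at h1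
    have := mul_le_mul_of_nonneg_left hd hK.nonneg
    linarith
  have e₁ := hend2 m₁ _ (hπ.mem _) hm₁
  have e₂ := hend2 m₂ _ (hπ.mem _) hm₂
  have hlen : (N : ℝ) + F.ncard + 1 ≤ |(m₁ : ℝ) - m₂| := by
    have h1 := dist_triangle4 (π (h • y)) (h • g ^ m₁ • q) (h • g ^ m₂ • q) (π (h • z))
    rw [dist_smul, dist_comm (h • g ^ m₂ • q)] at h1
    have h2 : dist (g ^ m₁ • q) (g ^ m₂ • q) ≤ _ := (hqg m₁ m₂).2
    rw [Int.dist_eq] at h2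
    have h3 : ν * ((N : ℝ) + F.ncard + 1) ≤ ν * |(m₁ : ℝ) - m₂| := by linarith
    exact le_of_mul_le_mul_left h3 (by linarith)
  have hlen' : (N : ℤ) + F.ncard + 1 ≤ |m₁ - m₂| := by exact_mod_cast hlen
  have hclose : ∀ i : ℤ, min m₁ m₂ ≤ i → i ≤ max m₁ m₂ →
      ∃ n : ℤ, dist (g ^ n • q) (h • g ^ i • q) ≤ M' := by
    intro i h1 h2
    have h3 := hM A π hπ _ (hqg.smul h) _ _ i h1 h2
      (by rcases min_choice m₁ m₂ with h | h <;> rw [h] <;> assumption)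
      (by rcases max_choice m₁ m₂ with h | h <;> rw [h] <;> assumption)
    obtain ⟨n, hn⟩ := hRc q hq _ (hπ.mem (h • g ^ i • q))
    have := dist_triangle_right (g ^ n • q) (h • g ^ i • q) (π (h • g ^ i • q))
    exact ⟨n, le_trans (by linarith) (le_max_right _ _)⟩
  choose! n hn using hclose
  set c := min m₁ m₂ with hc
  have hcmax : c + N + F.ncard + 1 ≤ max m₁ m₂ := by
    have := max_sub_min_eq_abs m₁ m₂
    rw [abs_sub_comm] at this
    omega
  -- Powers of `g` bring each orbit point of the overlap back near `q`, giving `F.ncard + 1` members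
  -- of `F`; a coincidence between two of them is the commensurating relation.
  have hmaps : ∀ i ∈ Finset.range (F.ncard + 1),
      g ^ (-n (c + i)) * h * g ^ (c + (i : ℤ)) ∈ hN.toFinset := by
    intro i hi
    rw [Finset.mem_range] at hi
    rw [Set.Finite.mem_toFinset]
    refine ⟨?_, n (c + i + N) - n (c + i), ?_⟩
    · rw [← dist_smul (g ^ n (c + i))]
      simp only [smul_smul, ← mul_assoc, ← zpow_add]
      simpa [mul_smul] using hn (c + i) (by omega) (by omega)
    · rw [← dist_smul (g ^ n (c + i)), dist_comm]
      have := hn (c + i + N) (by omega) (by omega)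
      rw [zpow_add _ _ (N : ℤ), zpow_natCast] at this
      simp only [smul_smul, ← mul_assoc, ← zpow_add]
      simpa [mul_smul] using this
  obtain ⟨i, -, j, -, hij, heq⟩ := Finset.exists_ne_map_eq_of_card_lt_of_maps_to
    (s := Finset.range (F.ncard + 1)) (t := hN.toFinset)
    (by rw [Finset.card_range, ← Set.ncard_eq_toFinset_card F hN]; omega) hmaps
  have hij' : (i : ℤ) - j ≠ 0 := by
    intro h0
    exact hij (by omega)
  have hconj : h * g ^ ((i : ℤ) - j) = g ^ (n (c + i) - n (c + j)) * h := by
    have h1 : g ^ (n (c + i)) * (g ^ (-n (c + i)) * h * g ^ (c + (i : ℤ))) * g ^ (-(c + (j : ℤ)))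
      = g ^ (n (c + i)) * (g ^ (-n (c + j)) * h * g ^ (c + (j : ℤ))) * g ^ (-(c + (j : ℤ))) :=
      congrArg (fun e => g ^ (n (c + i)) * e * g ^ (-(c + (j : ℤ)))) heq
    calc h * g ^ ((i : ℤ) - j)
        = g ^ (n (c + i)) * (g ^ (-n (c + i)) * h * g ^ (c + (i : ℤ))) * g ^ (-(c + (j : ℤ))) := by
          rw [show (i : ℤ) - j = (c + i) + -(c + j) by ring, zpow_add]
          group
      _ = _ := h1
      _ = _ := by rw [sub_eq_add_neg, zpow_add]; group
  refine ⟨_, _, hij', ?_, hconj⟩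
  intro h0
  rw [h0, zpow_zero, one_mul, mul_eq_left] at hconj
  exact hfin (isOfFinOrder_iff_zpow_eq_one.2 ⟨_, hij', hconj⟩)

/-- Elements commensurating `⟨g⟩` lie in the elementary hull. -/
theorem commensuratingSet_subset_elementaryHull {PS : PathSystem X} {C K : ℝ}
    (hK : IsCoarseConstant PS C K) {g : G} (hg : IsWPD X g) {A : Set X}
    (hA : IsCoboundedInvariant g A) {π : X → X} (hπ : IsProjection PS C A π) :
    commensuratingSet g ⊆ elementaryHull G A π := by
  rintro h ⟨a, b, -, hb, hab⟩
  obtain ⟨q, hq⟩ := hA.nonempty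
  obtain ⟨ν, hν, hqg⟩ := (hg.1 q).1
  obtain ⟨R, hR⟩ := hA.cobounded
  set r : ℝ := R + (ν * |(b : ℝ)| + ν) + dist q (h • q) with hr
  have hr0 : 0 ≤ r := by
    have := dist_nonneg.trans (hR q hq q hq).choose_spec
    positivity
  have hbd : ∀ x ∈ A, ∃ y ∈ A, dist x (π (h • y)) ≤ K * r + K + K := by
    intro x hx
    obtain ⟨n, hn⟩ := hR q hq x hx
    -- Rounding `n` down to a multiple of `b` gives an exponent at which the relation moves `h`
    -- across the power.
    have hmem : g ^ (a * (n / b)) • q ∈ A := hA.zpow_smul_mem _ hq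
    refine ⟨_, hmem, ?_⟩
    have h1 : dist (g ^ n • q) (g ^ (b * (n / b)) • q) ≤ ν * |(b : ℝ)| + ν := by
      refine (hqg n (b * (n / b))).2.trans ?_
      have : dist n (b * (n / b)) ≤ |(b : ℝ)| := by
        rw [Int.dist_eq', ← Int.emod_def, ← Int.cast_abs, abs_of_nonneg (Int.emod_nonneg n hb)]
        exact_mod_cast (Int.emod_lt_abs n hb).le
      have := mul_le_mul_of_nonneg_left this (by linarith : 0 ≤ ν)
      linarith
    have h2 : dist x (h • g ^ (a * (n / b)) • q) ≤ r := by
      have h3 : h • g ^ (a * (n / b)) • q = g ^ (b * (n / b)) • h • q := by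
        rw [smul_smul, mul_zpow_mul_eq hab, mul_smul]
      have h4 := dist_triangle4 x (g ^ n • q) (g ^ (b * (n / b)) • q) (g ^ (b * (n / b)) • h • q)
      rw [dist_comm x (g ^ n • q), dist_smul] at h4
      rw [h3]
      linarith
    have h5 := hK.lipschitz A π hπ x (h • g ^ (a * (n / b)) • q)
    have h6 := mul_le_mul_of_nonneg_left h2 hK.nonneg
    have h7 := hK.dist_le hπ hx
    have h8 := dist_triangle_left x (π (h • g ^ (a * (n / b)) • q)) (π x)
    linarith
  have hD0 : 0 ≤ K * r + K + K := by have := hK.nonneg; positivity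
  refine ne_top_of_le_ne_top (b := ENNReal.ofReal (K * r + K + K)) ENNReal.ofReal_ne_top
    (Metric.hausdorffEDist_le_of_mem_edist ?_ ?_)
  · rintro _ ⟨x, -, rfl⟩
    exact ⟨_, hπ.mem x, by simp⟩
  · intro x hx
    obtain ⟨y, hy, hxy⟩ := hbd x hx
    exact ⟨_, ⟨_, Set.smul_mem_smul_set hy, rfl⟩, by
      rw [edist_dist]; exact ENNReal.ofReal_le_ofReal hxy⟩

end Commensurating

/-! ### Chains of translates -/

section Chain

variable {G X : Type*} [Group G] [MetricSpace X] [MulAction G X] [IsIsometricSMul G X]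

/-- Local-to-global principle for chains of translates of a contracting set. -/
theorem IsCoarseConstant.chain {PS : PathSystem X} (hPS : PS.IsInvariant G) {C K : ℝ}
    (hK : IsCoarseConstant PS C K) {A : Set X} {π : X → X} (hπ : IsProjection PS C A π)
    {u : ℤ → G} {yp ym : ℤ → X} {K₀ : ℝ}
    (hp : ∀ i, ∀ a ∈ A, dist (u i • π ((u i)⁻¹ • u (i + 1) • a)) (yp i) ≤ K₀)
    (hm : ∀ i, ∀ a ∈ A, dist (u i • π ((u i)⁻¹ • u (i - 1) • a)) (ym i) ≤ K₀)
    (hd : ∀ i, 2 * K + 2 * K₀ ≤ dist (ym i) (yp i)) (n : ℕ) :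
    ∀ i, ∀ a ∈ A, dist (u i • π ((u i)⁻¹ • u (i + (n + 1)) • a)) (yp i) ≤ K₀ + K := by
  induction n with
  | zero =>
    intro i a ha
    have := hp i a ha
    simp only [Nat.cast_zero, zero_add]
    linarith [hK.nonneg]
  | succ n ih =>
    intro i a ha
    set x := u (i + ((n + 1 : ℕ) + 1)) • a with hx
    have h1 := ih (i + 1) a ha
    rw [show i + 1 + ((n : ℤ) + 1) = i + ((n + 1 : ℕ) + 1) by push_cast; ring, ← hx] at h1
    have h2 := hm (i + 1) _ (hπ.mem ((u i)⁻¹ • x))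
    rw [add_sub_cancel_right] at h2
    -- On `u (i + 1) • A` the point `x` projects near `yp (i + 1)` but `u i • A` near `ym (i + 1)`.
    -- So on `u i • A` the point `x` projects within `K` of a projected point of the adjacent
    -- translate, and the error does not grow with `n`.
    have h3 := hK.behrstock _ _ _ _ (hπ.smul hPS (u i)) (hπ.smul hPS (u (i + 1))) x (by
      have h4 := hd (i + 1)
      have h5 := dist_triangle4 (ym (i + 1))
        (u (i + 1) • π ((u (i + 1))⁻¹ • u i • π ((u i)⁻¹ • x)))
        (u (i + 1) • π ((u (i + 1))⁻¹ • x)) (yp (i + 1))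
      rw [dist_comm (ym (i + 1)) (u (i + 1) • _), dist_comm (u (i + 1) • _) (u (i + 1) • _)] at h5
      linarith)
    have h6 := hp i _ (hπ.mem ((u (i + 1))⁻¹ • x))
    have h7 := dist_triangle (u i • π ((u i)⁻¹ • x))
      (u i • π ((u i)⁻¹ • u (i + 1) • π ((u (i + 1))⁻¹ • x))) (yp i)
    linarith

/-- The projections of the translates of `A` by the positive and by the negative powers of `f` are
bounded, and are far from each other. -/
structure HasSeparatedTranslates (f : G) (A : Set X) (π : X → X) (am ap : X) (K₁ D : ℝ) :
    Prop where
  mem : ap ∈ A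
  le_dist : D ≤ dist am ap
  pos : ∀ j : ℤ, 0 < j → ∀ a ∈ A, dist (π (f ^ j • a)) ap ≤ K₁
  neg : ∀ j : ℤ, j < 0 → ∀ a ∈ A, dist (π (f ^ j • a)) am ≤ K₁

/-- Seen from `u i • A`, the next translate is `h i • A` and the previous one is `(g ^ n (i - 1))⁻¹
• (h (i - 1))⁻¹ • A`. Their projections are bounded, and `hlong` separates them by `D`. -/
theorem IsCoarseConstant.hasSeparatedTranslates {PS : PathSystem X} (hPS : PS.IsInvariant G)
    {C K : ℝ} (hK : IsCoarseConstant PS C K) {g : G} {A : Set X} (hA : IsCoboundedInvariant g A)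
    {π : X → X} (hπ : IsProjection PS C A π) {B D : ℝ} (hD : 6 * K + 2 * B ≤ D)
    {p : X} (hp : p ∈ A) {u h : ℤ → G} {n : ℤ → ℤ}
    (hB : ∀ i, ∀ y ∈ A, ∀ z ∈ A, dist (π (h i • y)) (π (h i • z)) ≤ B)
    (hB' : ∀ i, ∀ y ∈ A, ∀ z ∈ A, dist (π ((h i)⁻¹ • y)) (π ((h i)⁻¹ • z)) ≤ B)
    (hu : ∀ i, u (i + 1) = u i * h i * g ^ n i)
    (hlong : ∀ i, dist (π (h (i + 1) • p)) p + dist p (π ((h i)⁻¹ • p)) + D ≤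
      dist p (g ^ n i • p)) {f : G} {k : ℤ} (hk : 0 < k) (hf : ∀ j, u (k * j) = f ^ j) :
    ∃ am ap : X, HasSeparatedTranslates f A π am ap (B + 3 * K) D := by
  set yp : ℤ → X := fun i => u i • π (h i • p) with hyp
  set ym : ℤ → X := fun i => u i • (g ^ n (i - 1))⁻¹ • π ((h (i - 1))⁻¹ • p) with hym
  have hp' : ∀ i, ∀ a ∈ A, dist (u i • π ((u i)⁻¹ • u (i + 1) • a)) (yp i) ≤ B + 2 * K := by
    intro i a ha
    have h1 := hB i _ (hA.zpow_smul_mem (n i) ha) _ hp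
    simp only [hyp, dist_smul, hu, mul_smul, inv_smul_smul]
    linarith [hK.nonneg]
  have hm' : ∀ i, ∀ a ∈ A, dist (u i • π ((u i)⁻¹ • u (i - 1) • a)) (ym i) ≤ B + 2 * K := by
    intro i a ha
    have h0 : u i = u (i - 1) * h (i - 1) * g ^ n (i - 1) := by simpa using hu (i - 1)
    have h1 := hB' (i - 1) _ ha _ hp
    -- As `g` preserves `A`, this is another projection on `A`, hence close to `π`.
    have hρ := hπ.smul hPS (g ^ n (i - 1))⁻¹
    rw [← zpow_neg, hA.zpow_smul_set, zpow_neg] at hρ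
    have h2 := hK.dist_proj_proj_le hπ hρ ((g ^ n (i - 1))⁻¹ • (h (i - 1))⁻¹ • a)
    simp only [inv_inv, smul_inv_smul] at h2
    have h3 : (u i)⁻¹ • u (i - 1) • a = (g ^ n (i - 1))⁻¹ • (h (i - 1))⁻¹ • a := by
      simp only [smul_smul, h0]
      congr 1
      group
    rw [h3]
    simp only [hym, dist_smul]
    refine (dist_triangle _ ((g ^ n (i - 1))⁻¹ • π ((h (i - 1))⁻¹ • a)) _).trans ?_
    rw [dist_smul]
    linarith
  have hd' : ∀ i, D ≤ dist (ym i) (yp i) := by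
    intro i
    have h1 := hlong (i - 1)
    rw [sub_add_cancel] at h1
    have h2 := dist_triangle4 p (π ((h (i - 1))⁻¹ • p)) ((g ^ n (i - 1)) • π (h i • p))
      (g ^ n (i - 1) • p)
    rw [dist_smul] at h2
    have h3 : dist (ym i) (yp i) =
        dist (π ((h (i - 1))⁻¹ • p)) ((g ^ n (i - 1)) • π (h i • p)) := by
      simp only [hym, hyp]
      rw [dist_smul, ← dist_smul (g ^ n (i - 1)), smul_inv_smul]
    linarith
  have hpos := hK.chain hPS hπ hp' hm' (fun i => (by linarith : _ ≤ D).trans (hd' i))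
  -- The negative side is the same chain read backwards.
  have hneg := hK.chain hPS hπ (u := fun i => u (-i)) (yp := fun i => ym (-i))
    (ym := fun i => yp (-i)) (K₀ := B + 2 * K)
    (fun i a ha => by
      have := hm' (-i) a ha
      rwa [show -i - 1 = -(i + 1) by ring] at this)
    (fun i a ha => by
      have := hp' (-i) a ha
      rwa [show -i + 1 = -(i - 1) by ring] at this)
    (fun i => by rw [dist_comm]; exact (by linarith : _ ≤ D).trans (hd' (-i)))
  have hu0 : u 0 = 1 := by simpa using hf 0
  have hconv : B + 3 * K = B + 2 * K + K := by ring
  refine ⟨ym 0, yp 0, ?_, hd' 0, ?_, ?_⟩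
  · simp only [hyp, hu0, one_smul]
    exact hπ.mem _
  · intro j hj a ha
    have hkj : 0 < k * j := mul_pos hk hj
    have := hpos (k * j - 1).toNat 0 a ha
    rw [Int.toNat_of_nonneg (by omega), zero_add, sub_add_cancel, hu0, hf, inv_one, one_smul,
      one_smul] at this
    rw [hconv]
    exact this
  · intro j hj a ha
    have hkj : k * j < 0 := mul_neg_of_pos_of_neg hk hj
    have := hneg (-(k * j) - 1).toNat 0 a ha
    rw [Int.toNat_of_nonneg (by omega), zero_add, sub_add_cancel, neg_neg] at this
    simp only [neg_zero] at this
    rw [hu0, hf, inv_one, one_smul, one_smul] at this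
    rw [hconv]
    exact this

end Chain

/-! ### Separated translates give a contracting orbit -/

section Criterion

variable {G X : Type*} [Group G] [MetricSpace X] [MulAction G X]

theorem dist_zpow_smul_le [IsIsometricSMul G X] (f : G) (x : X) (n : ℤ) :
    dist x (f ^ n • x) ≤ |(n : ℝ)| * dist x (f • x) := by
  have key : ∀ k : ℕ, dist x (f ^ k • x) ≤ k * dist x (f • x) := by
    intro k
    have := dist_le_mul_of_step_le (z := fun j : ℕ => f ^ j • x) (S := dist x (f • x)) (n := k)
      (fun j _ => by rw [pow_succ, mul_smul, dist_smul])
    simpa using this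
  obtain ⟨k, rfl | rfl⟩ := Int.eq_nat_or_neg n
  · simpa using key k
  · rw [← dist_smul (f ^ (k : ℤ)), smul_smul, ← zpow_add, add_neg_cancel, zpow_zero, one_smul,
      dist_comm]
    simpa using key k

theorem isCoboundedInvariant_range (f : G) (x : X) :
    IsCoboundedInvariant f (Set.range fun n : ℤ => f ^ n • x) where
  nonempty := Set.range_nonempty _
  invariant := by
    ext z
    rw [Set.mem_smul_set_iff_inv_smul_mem]
    constructor
    · rintro ⟨n, hn⟩
      refine ⟨n + 1, ?_⟩
      simp only at hn ⊢
      rw [add_comm, zpow_add, zpow_one, mul_smul, hn, smul_inv_smul]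
    · rintro ⟨n, rfl⟩
      refine ⟨n - 1, ?_⟩
      simp only
      rw [sub_eq_add_neg, add_comm, zpow_add, zpow_neg_one, mul_smul]
  cobounded := by
    refine ⟨0, ?_⟩
    rintro _ ⟨i, rfl⟩ _ ⟨j, rfl⟩
    refine ⟨j - i, ?_⟩
    simp only
    rw [smul_smul, ← zpow_add, sub_add_cancel, dist_self]

/-- The translates of the contracting set `A` by the powers of `f` are so well separated that the
orbit of `ap` under `⟨f⟩` is contracting. -/
structure IsTranslationAlong (PS : PathSystem X) (C K : ℝ) (A : Set X) (π : X → X) (f : G)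
    (am ap : X) (K₁ D : ℝ) : Prop extends HasSeparatedTranslates f A π am ap K₁ D where
  invariant : PS.IsInvariant G
  const : IsCoarseConstant PS C K
  proj : IsProjection PS C A π
  nonneg : 0 ≤ K₁
  large : K₁ + 2 * K + K * (2 * K₁ + 6 * K) + 1 ≤ D

namespace IsTranslationAlong

variable {PS : PathSystem X} {C K : ℝ} {A : Set X} {π : X → X} {f : G}
  {am ap : X} {K₁ D : ℝ}

theorem large' (S : IsTranslationAlong PS C K A π f am ap K₁ D) : 3 * K₁ + 8 * K + 1 ≤ D := by
  have h1 := S.large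
  have h2 := S.nonneg
  have h3 := S.const.one_le
  nlinarith

variable [IsIsometricSMul G X]

/-- The hypothesis `hi` means that `x` lies beyond index `i`. Since `f ^ j • A` projects to `f ^ i •
A` near `f ^ i • am`, Behrstock forces `x` and `f ^ i • A` to project to nearby places on `f ^ j •
A`. -/
theorem dist_le_of_past (S : IsTranslationAlong PS C K A π f am ap K₁ D) {x : X} {i j : ℤ}
    (hi : K₁ + K + 1 ≤ dist (π (f ^ (-i) • x)) am) (hj : j < i) :
    dist (π (f ^ (-j) • x)) ap ≤ K₁ + K := by
  set z := f ^ (-j) • x with hz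
  have h0 : (f ^ (i - j))⁻¹ • z = f ^ (-i) • x := by
    rw [hz, ← zpow_neg, smul_smul, ← zpow_add]; congr 2; ring
  have hm := S.neg (-(i - j)) (by omega) _ (S.proj.mem z)
  have h1 := S.const.behrstock _ _ _ _ S.proj (S.proj.smul S.invariant (f ^ (i - j))) z (by
    rw [dist_smul, h0, ← zpow_neg]
    have := dist_triangle (π (f ^ (-i) • x)) (π (f ^ (-(i - j)) • π z)) am
    linarith)
  have h2 := S.pos (i - j) (by omega) _ (S.proj.mem ((f ^ (i - j))⁻¹ • z))
  linarith [dist_triangle (π z) (π (f ^ (i - j) • π ((f ^ (i - j))⁻¹ • z))) ap]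

theorem past_of_le (S : IsTranslationAlong PS C K A π f am ap K₁ D) {x : X} {i j : ℤ}
    (hi : K₁ + K + 1 ≤ dist (π (f ^ (-i) • x)) am) (hj : j ≤ i) :
    K₁ + K + 1 ≤ dist (π (f ^ (-j) • x)) am := by
  rcases hj.eq_or_lt with rfl | hj
  · exact hi
  have h1 := S.dist_le_of_past hi hj
  have h2 := dist_triangle_left am ap (π (f ^ (-j) • x))
  linarith [S.le_dist, S.large', S.const.one_le, S.nonneg]

theorem past_base_iff (S : IsTranslationAlong PS C K A π f am ap K₁ D) (i k : ℤ) :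
    K₁ + K + 1 ≤ dist (π (f ^ (-i) • f ^ k • ap)) am ↔ i ≤ k := by
  constructor
  · intro h
    by_contra! hik
    rw [smul_smul, ← zpow_add] at h
    have := S.neg (-i + k) (by omega) ap S.mem
    linarith [S.const.one_le]
  · intro hik
    refine S.past_of_le (i := k) ?_ hik
    rw [smul_smul, ← zpow_add, neg_add_cancel, zpow_zero, one_smul]
    have h1 := S.const.dist_le S.proj S.mem
    have h2 := dist_triangle_left am ap (π ap)
    linarith [S.le_dist, S.large', S.const.one_le, S.nonneg]

/-- On `f ^ k • A` the two points project near opposite ends, which are far apart, so the path must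
come near the projection of `y`. -/
theorem crossing (S : IsTranslationAlong PS C K A π f am ap K₁ D) {x y : X} {k : ℤ}
    (hx : ¬ K₁ + K + 1 ≤ dist (π (f ^ (-k) • x)) am)
    (hy : dist (π (f ^ (-k) • y)) ap ≤ K₁ + K) {δ : IntervalPath X} (hδ : δ ∈ PS.paths)
    (hend : (δ.source = x ∧ δ.target = y) ∨ (δ.source = y ∧ δ.target = x)) :
    ∃ t, dist (f ^ k • ap) (δ.toFun t) ≤ K₁ + 2 * K := by
  have hfar : K ≤ dist (f ^ k • π ((f ^ k)⁻¹ • x)) (f ^ k • π ((f ^ k)⁻¹ • y)) := by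
    rw [dist_smul, ← zpow_neg]
    have := dist_triangle4 am (π (f ^ (-k) • x)) (π (f ^ (-k) • y)) ap
    rw [dist_comm am (π (f ^ (-k) • x))] at this
    linarith [S.le_dist, S.large', S.const.one_le, S.nonneg]
  have hρ := S.proj.smul S.invariant (f ^ k)
  obtain ⟨t, ht⟩ : ∃ t, dist (f ^ k • π ((f ^ k)⁻¹ • y)) (δ.toFun t) ≤ K := by
    rcases hend with ⟨h1, h2⟩ | ⟨h1, h2⟩
    · exact (S.const.near _ _ hρ x y hfar δ hδ h1 h2).2
    · exact (S.const.near _ _ hρ y x (by rwa [dist_comm]) δ hδ h1 h2).1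
  refine ⟨t, ?_⟩
  have h1 : dist (f ^ k • π ((f ^ k)⁻¹ • y)) (f ^ k • ap) ≤ K₁ + K := by
    rw [dist_smul, ← zpow_neg]; exact hy
  linarith [dist_triangle_left (f ^ k • ap) (δ.toFun t) (f ^ k • π ((f ^ k)⁻¹ • y))]

/-- The Lipschitz projection separates the two points after translation; the product term in `large`
is there for this. -/
theorem lt_dist_base (S : IsTranslationAlong PS C K A π f am ap K₁ D) {i j : ℤ} (hij : i < j) :
    2 * K₁ + 6 * K < dist (f ^ i • ap) (f ^ j • ap) := by
  have h1 : dist (f ^ i • ap) (f ^ j • ap) = dist (f ^ (i - j) • ap) ap := by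
    rw [← dist_smul (f ^ (-j)), smul_smul, smul_smul, ← zpow_add, ← zpow_add, neg_add_cancel,
      zpow_zero, one_smul, neg_add_eq_sub]
  rw [h1]
  have h2 := S.neg (i - j) (by omega) ap S.mem
  have h3 := S.const.dist_le S.proj S.mem
  have h4 := S.const.lipschitz A π S.proj (f ^ (i - j) • ap) ap
  have h5 := dist_triangle4 am (π (f ^ (i - j) • ap)) (π ap) ap
  rw [dist_comm am (π (f ^ (i - j) • ap))] at h5
  have hK := S.const.one_le
  have h6 : K * (2 * K₁ + 6 * K) < K * dist (f ^ (i - j) • ap) ap := by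
    linarith [S.le_dist, S.large]
  exact lt_of_mul_lt_mul_left h6 (by linarith)

/-- Within unit time a special path moves at most `2 * K`, too little to be near two of the orbit
points. Each `k` thus uses up its own unit of parameter. -/
theorem sub_le_length (S : IsTranslationAlong PS C K A π f am ap K₁ D) {δ : IntervalPath X}
    (hδ : δ ∈ PS.paths) {a b : ℤ}
    (h : ∀ k, a ≤ k → k < b → ∃ t, dist (f ^ k • ap) (δ.toFun t) ≤ K₁ + 2 * K) :
    (b : ℝ) - a ≤ δ.hi - δ.lo + 1 := by
  have h' : ∀ k : ℤ, ∃ t, a ≤ k → k < b → dist (f ^ k • ap) (δ.toFun t) ≤ K₁ + 2 * K := by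
    intro k
    by_cases hk : a ≤ k ∧ k < b
    · obtain ⟨t, ht⟩ := h k hk.1 hk.2
      exact ⟨t, fun _ _ => ht⟩
    · exact ⟨⟨δ.lo, le_refl _, δ.le⟩, fun h1 h2 => absurd ⟨h1, h2⟩ hk⟩
  choose t ht using h'
  have hmaps : ∀ k ∈ Finset.Ico a b, ⌊(t k : ℝ) - δ.lo⌋₊ ∈ Finset.range (⌊δ.hi - δ.lo⌋₊ + 1) := by
    intro k _
    rw [Finset.mem_range, Nat.lt_succ_iff]
    exact Nat.floor_le_floor (by linarith [(t k).2.2])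
  have hinj : Set.InjOn (fun k => ⌊(t k : ℝ) - δ.lo⌋₊) (Finset.Ico a b : Set ℤ) := by
    have aux : ∀ i j : ℤ, a ≤ i → i < j → j < b →
        ⌊(t i : ℝ) - δ.lo⌋₊ ≠ ⌊(t j : ℝ) - δ.lo⌋₊ := by
      intro i j hai hij hjb heq
      have e1 := Nat.floor_le (sub_nonneg.2 (t i).2.1)
      have e2 := Nat.lt_floor_add_one ((t i : ℝ) - δ.lo)
      have e3 := Nat.floor_le (sub_nonneg.2 (t j).2.1)
      have e4 := Nat.lt_floor_add_one ((t j : ℝ) - δ.lo)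
      rw [heq] at e1 e2
      have hd : dist (t i) (t j) ≤ 1 := by
        rw [Subtype.dist_eq, Real.dist_eq, abs_le]
        constructor <;> linarith
      have h1 := S.const.path_dist δ hδ (t i) (t j)
      have h2 := mul_le_mul_of_nonneg_left hd S.const.nonneg
      have h3 := ht i hai (hij.trans hjb)
      have h4 := ht j (hai.trans hij.le) hjb
      have h5 := S.lt_dist_base hij
      have h6 := dist_triangle4 (f ^ i • ap) (δ.toFun (t i)) (δ.toFun (t j)) (f ^ j • ap)
      rw [dist_comm (δ.toFun (t j))] at h6
      linarith
    intro i hi j hj heq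
    simp only [Finset.coe_Ico, Set.mem_Ico] at hi hj
    rcases lt_trichotomy i j with h | h | h
    · exact absurd heq (aux i j hi.1 h hj.2)
    · exact h
    · exact absurd heq.symm (aux j i hj.1 h hi.2)
  have hcard := Finset.card_le_card_of_injOn _ hmaps hinj
  rw [Int.card_Ico, Finset.card_range] at hcard
  have h1 : b - a ≤ (⌊δ.hi - δ.lo⌋₊ : ℤ) + 1 := by omega
  have h2 : (b : ℝ) - a ≤ (⌊δ.hi - δ.lo⌋₊ : ℝ) + 1 := by exact_mod_cast h1
  linarith [Nat.floor_le (sub_nonneg.2 δ.le)]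

theorem sub_le_dist (S : IsTranslationAlong PS C K A π f am ap K₁ D) {x y : X} {i j : ℤ}
    (hx : ¬ K₁ + K + 1 ≤ dist (π (f ^ (-i) • x)) am)
    (hy : K₁ + K + 1 ≤ dist (π (f ^ (-j) • y)) am) :
    (j : ℝ) - i ≤ K * dist x y + K + 1 := by
  obtain ⟨δ, hδ, h1, h2⟩ := PS.connects x y
  have h3 := S.sub_le_length hδ (a := i) (b := j) fun k hik hkj =>
    S.crossing (fun h => hx (S.past_of_le h hik)) (S.dist_le_of_past hy hkj) hδ (Or.inl ⟨h1, h2⟩)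
  have h4 := S.const.length_le hδ
  rw [h1, h2] at h4
  linarith

/-- The indices behind `x` are closed downwards; comparison with `ap` through `sub_le_dist` shows
that they are bounded above and that some exist. -/
theorem exists_index (S : IsTranslationAlong PS C K A π f am ap K₁ D) (x : X) :
    ∃ n : ℤ, ∀ i, K₁ + K + 1 ≤ dist (π (f ^ (-i) • x)) am ↔ i ≤ n := by
  have hbdd : ∃ b : ℤ, ∀ i, K₁ + K + 1 ≤ dist (π (f ^ (-i) • x)) am → i ≤ b := by
    refine ⟨⌈1 + (K * dist ap x + K + 1)⌉, fun i hi => ?_⟩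
    have h1 : ¬ K₁ + K + 1 ≤ dist (π (f ^ (-1 : ℤ) • ap)) am := by
      have := (S.past_base_iff 1 0).not.2 (by norm_num)
      rwa [zpow_zero, one_smul] at this
    have := S.sub_le_dist h1 hi
    push_cast at this
    have h2 := Int.le_ceil (1 + (K * dist ap x + K + 1))
    exact_mod_cast (by linarith : (i : ℝ) ≤ ⌈1 + (K * dist ap x + K + 1)⌉)
  have hne : ∃ i : ℤ, K₁ + K + 1 ≤ dist (π (f ^ (-i) • x)) am := by
    by_contra! hcon
    have h1 : K₁ + K + 1 ≤ dist (π (f ^ (-0 : ℤ) • ap)) am := by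
      have := (S.past_base_iff 0 0).2 le_rfl
      rwa [zpow_zero, one_smul] at this
    have h2 := S.sub_le_dist (hcon (-⌈K * dist x ap + K + 1⌉ - 1)).not_ge h1
    push_cast at h2
    linarith [Int.le_ceil (K * dist x ap + K + 1)]
  obtain ⟨n, hn, hmax⟩ := Int.exists_greatest_of_bdd hbdd hne
  exact ⟨n, fun i => ⟨hmax i, fun hi => S.past_of_le hn hi⟩⟩

/-- The orbit of `ap` under `⟨f⟩` is contracting. -/
theorem exists_isProjection (S : IsTranslationAlong PS C K A π f am ap K₁ D) :
    ∃ (C' : ℝ) (ρ : X → X), 0 ≤ C' ∧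
      IsProjection PS C' (Set.range fun n : ℤ => f ^ n • ap) ρ := by
  choose n hn using S.exists_index
  have hstep : ∀ k : ℤ, dist (f ^ k • ap) (f ^ (k + 1) • ap) = dist ap (f • ap) := by
    intro k
    rw [zpow_add_one, mul_smul, dist_smul]
  have hK := S.const.one_le
  have hK1 := S.nonneg
  refine ⟨dist ap (f • ap) + (K₁ + 2 * K) + 1, fun x => f ^ n x • ap, by positivity,
    fun x => ⟨n x, rfl⟩, ?_, ?_⟩
  · rintro _ ⟨k, rfl⟩
    have : n (f ^ k • ap) = k := by
      apply le_antisymm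
      · exact (S.past_base_iff _ k).1 ((hn _ _).2 le_rfl)
      · exact (hn _ _).1 ((S.past_base_iff k k).2 le_rfl)
    simp only [this, dist_self]
    positivity
  · have aux : ∀ x y, n x < n y →
        dist ap (f • ap) + (K₁ + 2 * K) + 1 ≤ dist (f ^ n x • ap) (f ^ n y • ap) →
        ∀ δ ∈ PS.paths, (δ.source = x ∧ δ.target = y) ∨ (δ.source = y ∧ δ.target = x) →
        Metric.infDist (f ^ n x • ap) δ.image ≤ dist ap (f • ap) + (K₁ + 2 * K) + 1 ∧
        Metric.infDist (f ^ n y • ap) δ.image ≤ dist ap (f • ap) + (K₁ + 2 * K) + 1 := by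
      intro x y hlt hd δ hδ hend
      -- The constant exceeds one step of the orbit, so the indices are not adjacent: `n x + 1` and
      -- `n y - 1` are both crossed.
      have hlt2 : n x + 1 < n y := by
        by_contra hcon
        have h1 : n y = n x + 1 := by omega
        rw [h1, hstep] at hd
        linarith
      have hc : ∀ k, n x < k → k < n y → ∃ t, dist (f ^ k • ap) (δ.toFun t) ≤ K₁ + 2 * K :=
        fun k h1 h2 => S.crossing ((hn x k).not.2 (by omega))
          (S.dist_le_of_past ((hn y (n y)).2 le_rfl) h2) hδ hend
      obtain ⟨t, ht⟩ := hc (n x + 1) (by omega) hlt2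
      obtain ⟨t', ht'⟩ := hc (n y - 1) (by omega) (by omega)
      constructor
      · refine (Metric.infDist_le_dist_of_mem (Set.mem_range_self t)).trans ?_
        linarith [dist_triangle (f ^ n x • ap) (f ^ (n x + 1) • ap) (δ.toFun t), hstep (n x)]
      · refine (Metric.infDist_le_dist_of_mem (Set.mem_range_self t')).trans ?_
        have h1 := hstep (n y - 1)
        rw [sub_add_cancel] at h1
        linarith [dist_triangle_left (f ^ n y • ap) (δ.toFun t') (f ^ (n y - 1) • ap)]
    intro x y hd δ hδ hx hy
    rcases lt_trichotomy (n x) (n y) with h | h | h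
    · exact aux x y h hd δ hδ (Or.inl ⟨hx, hy⟩)
    · simp only [h, dist_self] at hd
      linarith [dist_nonneg (x := ap) (y := f • ap)]
    · exact (aux y x h (by rwa [dist_comm (f ^ n y • ap)]) δ hδ (Or.inr ⟨hx, hy⟩)).symm

theorem abs_sub_le (S : IsTranslationAlong PS C K A π f am ap K₁ D) (i j : ℤ) :
    |(i : ℝ) - j| ≤ K * dist (f ^ i • ap) (f ^ j • ap) + K + 2 := by
  have aux : ∀ i j : ℤ, (j : ℝ) - i ≤ K * dist (f ^ i • ap) (f ^ j • ap) + K + 2 := by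
    intro i j
    have := S.sub_le_dist ((S.past_base_iff (i + 1) i).not.2 (by omega))
      ((S.past_base_iff j j).2 le_rfl)
    push_cast at this
    linarith
  rw [abs_le]
  have h1 := aux i j
  have h2 := aux j i
  rw [dist_comm] at h2
  constructor <;> linarith

/-- Every orbit is at bounded distance from that of `ap`, which is contracting and therefore Morse.
-/
theorem hasMorseQuasiGeodesicOrbit (S : IsTranslationAlong PS C K A π f am ap K₁ D) (x : X) :
    HasMorseQuasiGeodesicOrbit f x := by
  have hK := S.const.one_le
  set r := dist ap x with hr
  have hr0 : 0 ≤ r := dist_nonneg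
  have hrn : ∀ n : ℤ, dist (f ^ n • ap) (f ^ n • x) = r := fun n => dist_smul _ _ _
  constructor
  · set ν : ℝ := K + (2 * K * r + K + 2) + dist x (f • x) with hν
    have hKr : 0 ≤ 2 * K * r := by positivity
    have hdf : 0 ≤ dist x (f • x) := dist_nonneg
    have hν1 : 1 ≤ ν := by linarith
    refine ⟨ν, hν1, fun i j => ⟨?_, ?_⟩⟩
    · have h1 := S.abs_sub_le i j
      have h2 := dist_triangle4 (f ^ i • ap) (f ^ i • x) (f ^ j • x) (f ^ j • ap)
      rw [dist_comm (f ^ j • x), hrn, hrn] at h2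
      have h3 := mul_le_mul_of_nonneg_left h2 S.const.nonneg
      have h4 : K * dist (f ^ i • x) (f ^ j • x) ≤ ν * dist (f ^ i • x) (f ^ j • x) := by
        gcongr; linarith
      have h5 : |(i : ℝ) - j| ≤ ν * (dist (f ^ i • x) (f ^ j • x) + ν) := by nlinarith
      have h6 : ν⁻¹ * |(i : ℝ) - j| ≤ ν⁻¹ * (ν * (dist (f ^ i • x) (f ^ j • x) + ν)) := by
        gcongr
      rw [inv_mul_cancel_left₀ (by linarith)] at h6
      rw [Int.dist_eq]
      linarith
    · have h1 := dist_zpow_smul_le f x (j - i)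
      rw [← dist_smul (f ^ i), smul_smul, ← zpow_add, add_sub_cancel, Int.cast_sub,
        abs_sub_comm] at h1
      rw [Int.dist_eq]
      have h2 : |(i : ℝ) - j| * dist x (f • x) ≤ |(i : ℝ) - j| * ν := by gcongr; linarith
      linarith
  · intro μ c hμ hc
    obtain ⟨C', ρ, hC', hρ⟩ := S.exists_isProjection
    obtain ⟨L, hL⟩ := exists_isCoarseConstant PS hC'
    obtain ⟨M, hM⟩ := hL.exists_morse_constant hμ hc (L * r + L)
    have hend : ∀ z ∈ Set.range (fun n : ℤ => f ^ n • x), dist z (ρ z) ≤ L * r + L := by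
      rintro _ ⟨n, rfl⟩
      have := hL.dist_proj_le _ ρ hρ (f ^ n • x) (f ^ n • ap) ⟨n, rfl⟩
      rwa [dist_comm (f ^ n • x) (f ^ n • ap), hrn] at this
    refine ⟨M + r, fun γ hγ hs ht y hy => ?_⟩
    obtain ⟨t, rfl⟩ := hy
    have h1 := hM _ ρ hρ γ hγ (hend _ hs) (hend _ ht) t
    obtain ⟨n, hn⟩ := hρ.mem (γ.toFun t)
    simp only at hn
    rw [← hn] at h1
    refine (Metric.infDist_le_dist_of_mem (Set.mem_range_self n)).trans ?_
    linarith [dist_triangle (γ.toFun t) (f ^ n • ap) (f ^ n • x), hrn n]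

theorem not_isOfFinOrder (S : IsTranslationAlong PS C K A π f am ap K₁ D) :
    ¬ IsOfFinOrder f := by
  intro h
  obtain ⟨n, hn0, hn⟩ := isOfFinOrder_iff_pow_eq_one.1 h
  have h1 := S.lt_dist_base (i := 0) (j := n) (by exact_mod_cast hn0)
  rw [zpow_natCast, hn, zpow_zero, dist_self] at h1
  linarith [S.nonneg, S.const.one_le]

end IsTranslationAlong

end Criterion

/-! ### WPD for the product -/

section WPD

variable {G X : Type*} [Group G] [MetricSpace X] [MulAction G X] [IsIsometricSMul G X]

/-- Translates of `A` on which a given special path has a long projection starting at roughly the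
same time are translates of each other by a commensurating element. -/
theorem IsCoarseConstant.inv_mul_mem_commensuratingSet {PS : PathSystem X}
    (hPS : PS.IsInvariant G) {C K : ℝ} (hK : IsCoarseConstant PS C K) {A : Set X} {π : X → X}
    (hπ : IsProjection PS C A π) {g : G} {B : ℝ}
    (hB : ∀ h : G, h ∉ commensuratingSet g → ∀ y ∈ A, ∀ z ∈ A, dist (π (h • y)) (π (h • z)) ≤ B)
    {x y : X} {δ : IntervalPath X} (hδ : δ ∈ PS.paths) {w₁ w₂ : G} {t₁ t₂ : Set.Icc δ.lo δ.hi}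
    (h₁ : dist (w₁ • π (w₁⁻¹ • x)) (δ.toFun t₁) ≤ K)
    (h₂ : dist (w₂ • π (w₂⁻¹ • x)) (δ.toFun t₂) ≤ K) (ht : dist t₁ t₂ ≤ 1)
    (hD₁ : 4 * (K * K) + 4 * K + B + 1 ≤ dist (w₁ • π (w₁⁻¹ • x)) (w₁ • π (w₁⁻¹ • y)))
    (hD₂ : 4 * (K * K) + 4 * K + B + 1 ≤ dist (w₂ • π (w₂⁻¹ • x)) (w₂ • π (w₂⁻¹ • y))) :
    w₁⁻¹ * w₂ ∈ commensuratingSet g := by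
  by_contra hw
  have hw' : w₂⁻¹ * w₁ ∉ commensuratingSet g := by
    intro h
    apply hw
    simpa using inv_mem_commensuratingSet h
  have hK0 := hK.nonneg
  have hbd : ∀ v w : G, v⁻¹ * w ∉ commensuratingSet g → ∀ y ∈ A, ∀ z ∈ A,
      dist (v • π (v⁻¹ • w • y)) (v • π (v⁻¹ • w • z)) ≤ B := by
    intro v w hvw y hy z hz
    rw [dist_smul, smul_smul, smul_smul]
    exact hB _ hvw y hy z hz
  have hx : dist (w₁ • π (w₁⁻¹ • x)) (w₂ • π (w₂⁻¹ • x)) ≤ 4 * K := by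
    have e1 := hK.path_dist δ hδ t₁ t₂
    have e2 := mul_le_mul_of_nonneg_left ht hK0
    have e3 := dist_triangle4 (w₁ • π (w₁⁻¹ • x)) (δ.toFun t₁) (δ.toFun t₂) (w₂ • π (w₂⁻¹ • x))
    rw [dist_comm (δ.toFun t₂)] at e3
    linarith
  have hproj : ∀ v w : G, dist (v • π (v⁻¹ • x)) (w • π (w⁻¹ • x)) ≤ 4 * K →
      dist (v • π (v⁻¹ • x)) (v • π (v⁻¹ • w • π (w⁻¹ • x))) ≤ 4 * (K * K) + 2 * K := by
    intro v w hvw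
    have hρ := hπ.smul hPS v
    have e1 := hK.lipschitz _ _ hρ (v • π (v⁻¹ • x)) (w • π (w⁻¹ • x))
    have e2 := mul_le_mul_of_nonneg_left hvw hK0
    have e3 := hK.dist_le hρ (Set.smul_mem_smul_set (hπ.mem (v⁻¹ • x)))
    have e4 := dist_triangle_left (v • π (v⁻¹ • x)) (v • π (v⁻¹ • w • π (w⁻¹ • x)))
      (v • π (v⁻¹ • v • π (v⁻¹ • x)))
    linarith
  have a1 := hproj w₁ w₂ hx
  have a2 := hproj w₂ w₁ (by rwa [dist_comm])
  have b1 := hbd w₁ w₂ hw _ (hπ.mem (w₂⁻¹ • x)) _ (hπ.mem (w₂⁻¹ • y))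
  have b2 := hbd w₂ w₁ hw' _ (hπ.mem (w₁⁻¹ • x)) _ (hπ.mem (w₁⁻¹ • y))
  -- On `w₁ • A`, the set `w₂ • A` projects near where `x` does, hence far from `y`. By Behrstock,
  -- `y` projects to `w₂ • A` near `w₁ • A`, hence near `x`, against `hD₂`.
  have hbeh := hK.behrstock _ _ _ _ (hπ.smul hPS w₂) (hπ.smul hPS w₁) y (by
    have := dist_triangle4 (w₁ • π (w₁⁻¹ • x)) (w₁ • π (w₁⁻¹ • w₂ • π (w₂⁻¹ • x)))
      (w₁ • π (w₁⁻¹ • w₂ • π (w₂⁻¹ • y))) (w₁ • π (w₁⁻¹ • y))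
    rw [dist_comm (w₁ • π (w₁⁻¹ • w₂ • π (w₂⁻¹ • y))) (w₁ • π (w₁⁻¹ • y))] at this
    linarith [mul_nonneg hK0 hK0])
  have := dist_triangle4 (w₂ • π (w₂⁻¹ • x)) (w₂ • π (w₂⁻¹ • w₁ • π (w₁⁻¹ • x)))
    (w₂ • π (w₂⁻¹ • w₁ • π (w₁⁻¹ • y))) (w₂ • π (w₂⁻¹ • y))
  rw [dist_comm (w₂ • π (w₂⁻¹ • w₁ • π (w₁⁻¹ • y))) (w₂ • π (w₂⁻¹ • y))] at this
  linarith [mul_nonneg hK0 hK0]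

namespace IsTranslationAlong

variable {PS : PathSystem X} {C K : ℝ} {A : Set X} {π : X → X} {f : G}
  {am ap : X} {K₁ D : ℝ}

/-- With `N = 2 * i` and `i` large, `h * f ^ i` puts `A` in the middle of the path, far from both
ends. Moving the ends by `R` hardly changes their projections there, so one fixed path has a long
projection to all these translates. -/
theorem exists_finite_base (S : IsTranslationAlong PS C K A π f am ap K₁ D) {g : G}
    (hg : IsWPD X g) (hA : IsCoboundedInvariant g A) {B : ℝ} (hB0 : 0 ≤ B)
    (hB : ∀ h : G, h ∉ commensuratingSet g → ∀ y ∈ A, ∀ z ∈ A, dist (π (h • y)) (π (h • z)) ≤ B)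
    (hD : 4 * (K * K) + 6 * K + 2 * K₁ + B + 1 ≤ D) (R : ℝ) :
    ∃ N : ℕ, {h : G | dist ap (h • ap) ≤ R ∧
      dist ((h * f ^ N) • ap) (f ^ N • ap) ≤ R}.Finite := by
  have hK := S.const.one_le
  have hK0 := S.const.nonneg
  have hKK := mul_nonneg hK0 hK0
  have hKB : K ≤ 4 * (K * K) + 4 * K + B + 1 := by linarith
  set Q : ℝ := K * (K * R + K) + 2 * K + K₁ + dist am ap with hQ
  set i : ℕ := ⌈K * Q + K + 2⌉₊ + 1 with hi
  have hfar : ∀ j k : ℤ, |(j : ℝ) - k| = i → Q < dist (f ^ j • ap) (f ^ k • ap) := by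
    intro j k hjk
    have h1 := S.abs_sub_le j k
    rw [hjk, hi] at h1
    push_cast at h1
    have h2 := Nat.le_ceil (K * Q + K + 2)
    have h3 : K * Q < K * dist (f ^ j • ap) (f ^ k • ap) := by linarith
    exact lt_of_mul_lt_mul_left h3 hK0
  set N := i + i with hN
  refine ⟨N, ?_⟩
  set H := {h : G | dist ap (h • ap) ≤ R ∧ dist ((h * f ^ N) • ap) (f ^ N • ap) ≤ R} with hH
  -- Projections to `h f ^ i A` of a point and of its image under `h` are close.
  have hcl : ∀ (h : G) (j : ℤ) (a : X), |(j : ℝ) - i| = i →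
      dist (f ^ j • ap) (h • f ^ j • ap) ≤ R →
      dist (π (f ^ (-(i : ℤ)) • f ^ j • ap)) a ≤ K₁ → dist a ap ≤ dist am ap →
      dist ((h * f ^ i) • π ((h * f ^ i)⁻¹ • f ^ j • ap)) ((h * f ^ i) • a) ≤ K + K₁ := by
    intro h j a hj hR ha haap
    set w := h * f ^ i with hw
    have hρ := S.proj.smul S.invariant w
    have e0 : w⁻¹ • h • f ^ j • ap = f ^ (-(i : ℤ)) • f ^ j • ap := by
      rw [hw, smul_smul, mul_inv_rev, inv_mul_cancel_right, zpow_neg, zpow_natCast]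
    have e1 : dist (w • π (w⁻¹ • h • f ^ j • ap)) (w • a) ≤ K₁ := by
      rw [dist_smul, e0]; exact ha
    have e2 : dist (w • π (w⁻¹ • f ^ j • ap)) (w • π (w⁻¹ • h • f ^ j • ap)) ≤ K := by
      -- Otherwise the path of bounded length from `f ^ j • ap` to its image would reach the
      -- translate near `w • a`, which is too far away by the choice of `Q` and `i`.
      by_contra! hcon
      obtain ⟨δ, hδ, hs, ht⟩ := PS.connects (f ^ j • ap) (h • f ^ j • ap)
      obtain ⟨t, htt⟩ := (S.const.near _ _ hρ _ _ hcon.le δ hδ hs ht).2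
      have e3 := S.const.dist_target_le hδ t
      rw [hs, ht] at e3
      have e4 : K * (K * dist (f ^ j • ap) (h • f ^ j • ap) + K) ≤ K * (K * R + K) := by gcongr
      have e5 := hfar j i hj
      have e6 : dist (f ^ j • ap) (f ^ (i : ℤ) • ap) = dist (h • f ^ j • ap) (w • ap) := by
        rw [hw, mul_smul, dist_smul, zpow_natCast]
      have e7 := dist_triangle4 (h • f ^ j • ap) (δ.toFun t) (w • π (w⁻¹ • h • f ^ j • ap)) (w • a)
      have e8 := dist_triangle (h • f ^ j • ap) (w • a) (w • ap)
      rw [dist_smul w] at e8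
      rw [dist_comm _ (δ.toFun t), dist_comm (δ.toFun t) (w • _)] at e7
      linarith
    linarith [dist_triangle (w • π (w⁻¹ • f ^ j • ap)) (w • π (w⁻¹ • h • f ^ j • ap)) (w • a)]
  have hi0 : 0 < i := by omega
  have hx : ∀ h ∈ H, dist ((h * f ^ i) • π ((h * f ^ i)⁻¹ • ap)) ((h * f ^ i) • am) ≤ K + K₁ := by
    rintro h ⟨h1, -⟩
    have := hcl h 0 am (by simp) (by simpa using h1)
      (by
        rw [smul_smul, ← zpow_add, add_zero]
        exact S.neg _ (by omega) _ S.mem) le_rfl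
    simpa using this
  have hy : ∀ h ∈ H, dist ((h * f ^ i) • π ((h * f ^ i)⁻¹ • f ^ N • ap)) ((h * f ^ i) • ap) ≤
      K + K₁ := by
    rintro h ⟨-, h1⟩
    have := hcl h N ap (by rw [hN]; push_cast; simp)
      (by rw [zpow_natCast, dist_comm, smul_smul]; exact h1)
      (by
        rw [smul_smul, ← zpow_add]
        exact S.pos _ (by omega) _ S.mem) (by rw [dist_self]; exact dist_nonneg)
    rwa [zpow_natCast] at this
  have hlong : ∀ h ∈ H, 4 * (K * K) + 4 * K + B + 1 ≤
      dist ((h * f ^ i) • π ((h * f ^ i)⁻¹ • ap))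
        ((h * f ^ i) • π ((h * f ^ i)⁻¹ • f ^ N • ap)) := by
    intro h hh
    have e1 := hx h hh
    have e2 := hy h hh
    have e3 := dist_triangle4 ((h * f ^ i) • am) ((h * f ^ i) • π ((h * f ^ i)⁻¹ • ap))
        ((h * f ^ i) • π ((h * f ^ i)⁻¹ • f ^ N • ap)) ((h * f ^ i) • ap)
    rw [dist_comm ((h * f ^ i) • am) ((h * f ^ i) • π _), dist_smul _ am] at e3
    linarith [S.le_dist]
  obtain ⟨δ, hδ, hs, ht⟩ := PS.connects ap (f ^ N • ap)
  have htime : ∀ h ∈ H, ∃ t, dist ((h * f ^ i) • π ((h * f ^ i)⁻¹ • ap)) (δ.toFun t) ≤ K :=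
    fun h hh => (S.const.near _ _ (S.proj.smul S.invariant (h * f ^ i)) _ _
      (hKB.trans (hlong h hh)) δ hδ hs ht).1
  have : Nonempty (Set.Icc δ.lo δ.hi) := ⟨⟨δ.lo, le_refl _, δ.le⟩⟩
  choose! t ht using htime
  -- Sort by the integer part of the entry time; within a class, elements differ by commensurating
  -- ones of bounded displacement.
  refine Set.Finite.subset (s := ⋃ k ∈ Set.Icc ⌊δ.lo⌋ ⌊δ.hi⌋, {h ∈ H | ⌊(t h : ℝ)⌋ = k})
    ((Set.finite_Icc _ _).biUnion fun k _ => ?_) ?_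
  · rcases Set.eq_empty_or_nonempty {h ∈ H | ⌊(t h : ℝ)⌋ = k} with he | ⟨h₀, hh₀, hk₀⟩
    · rw [he]; exact Set.finite_empty
    refine ((finite_commensuratingSet_inter S.const hg hA S.proj S.mem
      (2 * R + 2 * dist ap (f ^ i • ap))).image
        (fun e => h₀ * f ^ i * e * (f ^ i)⁻¹)).subset ?_
    rintro h ⟨hh, hk⟩
    refine ⟨(h₀ * f ^ i)⁻¹ * (h * f ^ i), ⟨?_, ?_⟩, ?_⟩
    · refine S.const.inv_mul_mem_commensuratingSet S.invariant S.proj hB hδ (ht h₀ hh₀) (ht h hh)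
        ?_ (hlong _ hh₀) (hlong _ hh)
      rw [Subtype.dist_eq, Real.dist_eq]
      exact (Int.abs_sub_lt_one_of_floor_eq_floor (hk₀.trans hk.symm)).le
    · rw [← dist_smul (h₀ * f ^ i), smul_smul, mul_inv_cancel_left]
      have e1 := dist_triangle4 (h₀ • f ^ i • ap) (h₀ • ap) (h • ap) (h • f ^ i • ap)
      have e2 := dist_triangle_left (h₀ • ap) (h • ap) ap
      rw [dist_smul, dist_smul, dist_comm (f ^ i • ap)] at e1
      rw [mul_smul, mul_smul]
      linarith [hh.1, hh₀.1]
    · group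
  · intro h hh
    simp only [Set.mem_iUnion]
    exact ⟨⌊(t h : ℝ)⌋, ⟨Int.floor_le_floor (t h).2.1, Int.floor_le_floor (t h).2.2⟩, hh, rfl⟩

theorem isWeaklyContracting (S : IsTranslationAlong PS C K A π f am ap K₁ D) {g : G}
    (hg : IsWPD X g) (hA : IsCoboundedInvariant g A) {B : ℝ} (hB0 : 0 ≤ B)
    (hB : ∀ h : G, h ∉ commensuratingSet g → ∀ y ∈ A, ∀ z ∈ A, dist (π (h • y)) (π (h • z)) ≤ B)
    (hD : 4 * (K * K) + 6 * K + 2 * K₁ + B + 1 ≤ D) : IsWeaklyContracting PS f := by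
  refine ⟨S.not_isOfFinOrder, ⟨S.hasMorseQuasiGeodesicOrbit, fun R _ x => ?_⟩, ?_⟩
  · obtain ⟨N, hN⟩ := S.exists_finite_base hg hA hB0 hB hD (R + 2 * dist ap x)
    refine ⟨N, hN.subset ?_⟩
    rintro h ⟨h1, h2⟩
    constructor
    · have := dist_triangle4 ap x (h • x) (h • ap)
      rw [dist_smul, dist_comm x ap] at this
      linarith
    · have := dist_triangle4 ((h * f ^ N) • ap) ((h * f ^ N) • x) (f ^ N • x) (f ^ N • ap)
      rw [dist_smul, dist_smul (f ^ N), dist_comm x ap] at this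
      linarith
  · obtain ⟨C', ρ, -, hρ⟩ := S.exists_isProjection
    exact ⟨C', _, ρ, isCoboundedInvariant_range f ap, hρ⟩

end IsTranslationAlong

end WPD

/-! ### Invariance under conjugation -/

section Conjugation

theorem conj_zpow_smul {G X : Type*} [Group G] [MulAction G X] (f k : G) (n : ℤ) (x : X) :
    (k * f * k⁻¹) ^ n • x = k • f ^ n • k⁻¹ • x := by
  rw [conj_zpow, mul_smul, mul_smul]

variable {G X : Type*} [Group G] [MetricSpace X] [MulAction G X] [IsIsometricSMul G X]

theorem HasMorseQuasiGeodesicOrbit.conj {f : G} {x : X} {k : G}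
    (h : HasMorseQuasiGeodesicOrbit f (k⁻¹ • x)) :
    HasMorseQuasiGeodesicOrbit (k * f * k⁻¹) x := by
  obtain ⟨⟨ν, hν, hq⟩, hM⟩ := h
  have hrange : Set.range (fun n : ℤ => (k * f * k⁻¹) ^ n • x) =
      (fun z => k • z) '' Set.range (fun n : ℤ => f ^ n • k⁻¹ • x) := by
    simp only [← Set.range_comp, Function.comp_def, conj_zpow_smul]
  have hmem : ∀ z ∈ Set.range (fun n : ℤ => (k * f * k⁻¹) ^ n • x),
      k⁻¹ • z ∈ Set.range (fun n : ℤ => f ^ n • k⁻¹ • x) := by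
    rintro _ ⟨n, rfl⟩
    exact ⟨n, by simp only [conj_zpow_smul, inv_smul_smul]⟩
  refine ⟨⟨ν, hν, fun i j => ?_⟩, fun μ c hμ hc => ?_⟩
  · simp only [conj_zpow_smul, dist_smul]
    exact hq i j
  · obtain ⟨M, hM⟩ := hM μ c hμ hc
    refine ⟨M, fun γ hγ hs ht y hy => ?_⟩
    have h1 := hM (γ.map fun z => k⁻¹ • z)
      (fun s t => by
        simp only [IntervalPath.map, dist_smul]
        exact hγ s t)
      (hmem _ hs) (hmem _ ht) (k⁻¹ • y) (by
        obtain ⟨t, rfl⟩ := hy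
        exact ⟨t, rfl⟩)
    rw [hrange, ← smul_inv_smul k y, Metric.infDist_image (isometry_smul X k)]
    exact h1

theorem IsWeaklyContracting.conj {PS : PathSystem X} (hPS : PS.IsInvariant G) {f : G}
    (hf : IsWeaklyContracting PS f) (k : G) : IsWeaklyContracting PS (k * f * k⁻¹) := by
  obtain ⟨hfin, ⟨hM, hW⟩, C, A, π, hA, hπ⟩ := hf
  refine ⟨?_, ⟨fun x => (hM _).conj, fun R hR x => ?_⟩, C, k • A, _, ⟨?_, ?_, ?_⟩,
    hπ.smul hPS k⟩
  · intro h
    apply hfin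
    obtain ⟨n, hn0, hn⟩ := isOfFinOrder_iff_pow_eq_one.1 h
    refine isOfFinOrder_iff_pow_eq_one.2 ⟨n, hn0, ?_⟩
    rw [conj_pow] at hn
    exact conj_eq_one_iff.1 hn
  · obtain ⟨N, hN⟩ := hW R hR (k⁻¹ • x)
    refine ⟨N, (hN.image fun h => k * h * k⁻¹).subset ?_⟩
    rintro h ⟨h1, h2⟩
    refine ⟨k⁻¹ * h * k, ⟨?_, ?_⟩, by group⟩
    · rw [smul_smul, mul_inv_cancel_right, mul_smul, dist_smul]
      exact h1
    · rw [← dist_smul k]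
      convert h2 using 2
      · simp only [smul_smul, conj_pow]
        congr 1
        group
      · simp only [conj_pow, mul_smul]
  · exact hA.nonempty.smul_set
  · rw [smul_smul, inv_mul_cancel_right, mul_smul, hA.invariant]
  · obtain ⟨R, hR⟩ := hA.cobounded
    refine ⟨R, ?_⟩
    rintro _ ⟨x, hx, rfl⟩ _ ⟨y, hy, rfl⟩
    obtain ⟨n, hn⟩ := hR x hx y hy
    refine ⟨n, ?_⟩
    simp only [conj_zpow_smul, inv_smul_smul, dist_smul]
    exact hn

end Conjugation

/-! ### Assembling the constants and the theorem -/

section Products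

variable {G X : Type*} [Group G] [MetricSpace X] [MulAction G X] [IsIsometricSMul G X]

/-- Products along a sufficiently long chain of translates of `A` are weakly contracting. The
constants come from one element `g₀` with axis `A`, and `g` is any other one. -/
theorem exists_isWeaklyContracting_of_chain {PS : PathSystem X} (hPS : PS.IsInvariant G) {C : ℝ}
    {A : Set X} {g₀ : G} {π₀ : X → X} (hg₀ : IsWeaklyContracting PS g₀)
    (hax₀ : IsContractingAxis PS g₀ C A π₀) :
    ∃ D : ℝ, ∀ (g : G) (π : X → X), IsContractingAxis PS g C A π → ∀ p ∈ A,
      ∀ (u h : ℤ → G) (n : ℤ → ℤ), (∀ i, h i ∉ elementaryHull G A π) →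
      (∀ i, u (i + 1) = u i * h i * g ^ n i) →
      (∀ i, dist (π (h (i + 1) • p)) p + dist p (π ((h i)⁻¹ • p)) + D ≤ dist p (g ^ n i • p)) →
      ∀ (f : G) (k : ℤ), 0 < k → (∀ j, u (k * j) = f ^ j) → IsWeaklyContracting PS f := by
  obtain ⟨hA₀, hπ₀⟩ := hax₀
  obtain ⟨a, ha⟩ := hA₀.nonempty
  have hC : 0 ≤ C := dist_nonneg.trans (hπ₀.dist_le a ha)
  obtain ⟨K, hK⟩ := exists_isCoarseConstant PS hC
  obtain ⟨B', hB'⟩ := exists_bound_or_mem_commensuratingSet hPS hK hg₀.1 hg₀.2.1 hA₀ hπ₀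
  set B := max 0 B' with hBdef
  have hB0 : 0 ≤ B := le_max_left _ _
  have hB : ∀ h : G, h ∉ commensuratingSet g₀ → ∀ y ∈ A, ∀ z ∈ A,
      dist (π₀ (h • y)) (π₀ (h • z)) ≤ B :=
    fun h hh y hy z hz => (hB' h hh y hy z hz).trans (le_max_right _ _)
  have hK0 := hK.nonneg
  set K₁ := B + 3 * K with hK₁
  have hKK : 0 ≤ K * K := mul_nonneg hK0 hK0
  have hKK₁ : 0 ≤ K * (2 * K₁ + 6 * K) := by positivity
  -- The three summands serve the chain, the contracting orbit and WPD respectively.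
  set D := (6 * K + 2 * B) + (K₁ + 2 * K + K * (2 * K₁ + 6 * K) + 1) +
    (4 * (K * K) + 6 * K + 2 * K₁ + B + 1) with hD
  -- The extra `4 * K` pays for replacing `π` by `π₀` twice.
  refine ⟨D + 4 * K, fun g π hax p hp u h n hh hu hlong f k hk hf => ?_⟩
  -- The hull is determined by `A` and `π`, not by `g`, so it contains the commensurating set of
  -- `g₀` as well.
  have hhE : ∀ i, h i ∉ commensuratingSet g₀ := fun i hi =>
    hh i (commensuratingSet_subset_elementaryHull hK hg₀.2.1 hA₀ hax.2 hi)
  obtain ⟨am, ap, hsep⟩ := hK.hasSeparatedTranslates hPS hax.1 hπ₀ (B := B) (D := D) (by linarith)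
    hp (fun i => hB _ (hhE i))
    (fun i => hB _ fun hi => hhE i (by simpa using inv_mem_commensuratingSet hi)) hu
    (fun i => by
      have h1 := hlong i
      have h2 := hK.dist_proj_proj_le hπ₀ hax.2 (h (i + 1) • p)
      have h3 := hK.dist_proj_proj_le hax.2 hπ₀ ((h i)⁻¹ • p)
      have h4 := dist_triangle (π₀ (h (i + 1) • p)) (π (h (i + 1) • p)) p
      have h5 := dist_triangle p (π ((h i)⁻¹ • p)) (π₀ ((h i)⁻¹ • p))
      linarith) hk hf
  have S : IsTranslationAlong PS C K A π₀ f am ap K₁ D :=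
    { hsep with
      invariant := hPS
      const := hK
      proj := hπ₀
      nonneg := by positivity
      large := by linarith }
  exact S.isWeaklyContracting hg₀.2.1 hA₀ hB0 hB (by linarith)

end Products

theorem mainTheorem7 {G X : Type*} [Group G] [MetricSpace X] [MulAction G X]
    [IsIsometricSMul G X] (PS : PathSystem X) (hPS : PS.IsInvariant G)
    (C : ℝ) (A : Set X) :
    ∃ D : ℝ, ∀ (g : G) (π : X → X), IsWeaklyContracting PS g → IsContractingAxis PS g C A π →
      ∀ p ∈ A,
        (∀ h : G, h ∉ elementaryHull G A π →
          dist (π (h • p)) p + dist p (π (h⁻¹ • p)) + D ≤ dist p (g • p) →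
          IsWeaklyContracting PS (h * g) ∧
            ∀ k : G, IsWeaklyContracting PS (k * (h * g) * k⁻¹)) ∧
        (∀ (h₁ h₂ : G) (n₁ n₂ : ℤ), h₁ ∉ elementaryHull G A π → h₂ ∉ elementaryHull G A π →
          dist (π (h₁⁻¹ • p)) p + dist p (π (h₂ • p)) + D ≤ dist p (g ^ n₁ • p) →
          dist (π (h₁ • p)) p + dist p (π (h₂⁻¹ • p)) + D ≤ dist p (g ^ n₂ • p) →
          IsWeaklyContracting PS (h₁ * g ^ n₁ * h₂ * g ^ n₂) ∧
            ∀ k : G, IsWeaklyContracting PS (k * (h₁ * g ^ n₁ * h₂ * g ^ n₂) * k⁻¹)) := by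
  by_cases hex : ∃ (g₀ : G) (π₀ : X → X), IsWeaklyContracting PS g₀ ∧ IsContractingAxis PS g₀ C A π₀
  swap
  -- With no such element the claim is vacuous and any constant will do.
  · exact ⟨0, fun g π hg hax => absurd ⟨g, π, hg, hax⟩ hex⟩
  obtain ⟨g₀, π₀, hg₀, hax₀⟩ := hex
  obtain ⟨D, hD⟩ := exists_isWeaklyContracting_of_chain hPS hg₀ hax₀
  refine ⟨D, fun g π _ hax p hp => ⟨fun h hh hlong => ?_, fun h₁ h₂ n₁ n₂ hh₁ hh₂ hl₁ hl₂ => ?_⟩⟩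
  · have key : IsWeaklyContracting PS (h * g) :=
      hD g π hax p hp (fun i => (h * g) ^ i) (fun _ => h) (fun _ => 1) (fun _ => hh)
        (fun i => by rw [zpow_add_one, zpow_one, mul_assoc]) (fun i => by rwa [zpow_one]) _ 1
        one_pos (fun j => by rw [one_mul])
    exact ⟨key, key.conj hPS⟩
  · have key : IsWeaklyContracting PS (h₁ * g ^ n₁ * h₂ * g ^ n₂) := by
      set f := h₁ * g ^ n₁ * h₂ * g ^ n₂ with hf
      -- A chain of period two: even indices are powers of `f`, odd ones stop after the first half
      -- of the product.
      refine hD g π hax p hp (fun i => f ^ (i / 2) * if Even i then 1 else h₁ * g ^ n₁)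
        (fun i => if Even i then h₁ else h₂) (fun i => if Even i then n₁ else n₂) (fun i => ?_)
        (fun i => ?_) (fun i => ?_) f 2 two_pos (fun j => ?_)
      · by_cases hi : Even i <;> simp only [hi, if_true, if_false] <;> assumption
      · rcases Int.even_or_odd' i with ⟨j, rfl | rfl⟩
        · rw [show (2 * j + 1) / 2 = j by omega, show 2 * j / 2 = j by omega]
          simp [mul_assoc]
        · rw [show (2 * j + 1 + 1) / 2 = j + 1 by omega, show (2 * j + 1) / 2 = j by omega,
            zpow_add_one, if_pos (by rw [add_assoc]; exact (even_two_mul j).add even_two)]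
          simp only [Int.not_even_two_mul_add_one, if_false, hf, mul_assoc, mul_one]
      · by_cases hi : Even i
        · simp only [Int.even_add_one, hi, not_true_eq_false, if_true, if_false]
          rw [dist_comm p] at hl₁
          rw [dist_comm p (π _), add_comm (dist (π _) p)]
          linarith [dist_comm p (g ^ n₁ • p)]
        · simp only [Int.even_add_one, hi, not_false_eq_true, if_true, if_false]
          exact hl₂
      · simp
    exact ⟨key, key.conj hPS⟩
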